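/- A $k$-uniform hypergraph $G$ consists of a finite vertex set $V(G)$ and a set $E(G)\neq\emptyset$ of $k$-element subsets of $V(G)$ (edges); its size is $|E(G)|$, and $d_i$ is the number of edges containing the vertex $i$. Its ABC tensor is the tensor of order $k$ indexed by $V(G)$ with entries \[ \mathcal{ABC}(G)_{i_1,\dots,i_k}=\frac{1}{(k-1)!}\left(\frac{\sum_{i\in e}d_i-k}{\prod_{i\in e}d_i}\right)^{1/k}\ \text{ if } e=\{i_1,\dots,i_k\}\in E(G), \] and $0$ otherwise. The ABC spectral radius $\rho_{\mathcal{ABC}}(G)$ is the maximum modulus of the eigenvalues of this tensor, where $\lambda\in\mathbb{C}$ is an eigenvalue of a tensor $\mathcal T$ of order $k$ if there is a nonzero complex vector $x$ with $\sum_{i_2,\dots,i_k}\mathcal{T}_{i,i_2,\dots,i_k}x_{i_2}\cdots x_{i_k}=\lambda x_i^{k-1}$ for all $i$. A cycle in $G$ of length $\ell\ge 2$ is given by a set of distinct vertices $v_1,\dots,v_\ell$ and a set of distinct edges $e_1,\dots,e_\ell$ such that $\{v_i,v_{i+1}\}\subseteq e_i$ for all $i$ (indices modulo $\ell$) and $e_i\cap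 e_j=\emptyset$ whenever $i\ne j$ and $i,j$ are not cyclically consecutive. $G$ is unicyclic if it is connected and has exactly one cycle. For $k\ge 3$, the $k$-th power $H^k$ of an ordinary (finite simple) graph $H$ is the $k$-uniform hypergraph obtained by adding to each edge of $H$ its own $k-2$ new vertices; a $k$-uniform power hypergraph is one isomorphic to $H^k$ for some graph $H$. Let $U_{m,3}$ be the graph obtained from a triangle by adding $m-3$ pendant edges at one of its vertices. **Statement.** Let $k\ge 3$ and let $G$ be a $k$-uniform power hypergraph that is unicyclic and has size $m\ge 3$. Then \[ \rho_{\mathcal{ABC}}(G)\le a_m^{2/k}, \] with equality if and only if $G\cong U_{m,3}^k$, where $a_m$ is the largest real root of \[ t^3-\frac{\sqrt2}{2}t^2-\frac{m^2-4m+5}{m-1}\,t+\frac{\sqrt2\,(m^2-5m+6)}{2(m-1)}=0 . \] -/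

import Mathlib

/-- A tensor of order `k` with index set `V`: the entry `T_{i₁,i₂,…,i_k}` is written
`T i₁ (i₂,…,i_k)`, the last `k - 1` indices being collected in a tuple. -/
abbrev RealTensor (V : Type*) (k : ℕ) : Type _ := V → (Fin (k - 1) → V) → ℝ

namespace RealTensor

variable {V : Type*} [Fintype V] {k : ℕ}

/-- The vector `T x^{k-1}`. -/
noncomputable def apply (T : RealTensor V k) (x : V → ℂ) (i : V) : ℂ :=
  ∑ t : Fin (k - 1) → V, (T i t : ℂ) * ∏ j, x (t j)

/-- `z` is an eigenvalue: `T x^{k-1} = z x^{[k-1]}` has a nonzero complex solution `x`. -/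
def IsEigenvalue (T : RealTensor V k) (z : ℂ) : Prop :=
  ∃ x : V → ℂ, x ≠ 0 ∧ ∀ i, T.apply x i = z * x i ^ (k - 1)

/-- The set of moduli of the eigenvalues. -/
def eigenvalueModuli (T : RealTensor V k) : Set ℝ :=
  {r | ∃ z : ℂ, T.IsEigenvalue z ∧ r = ‖z‖}

/-- The spectral radius: the largest modulus of an eigenvalue. -/
noncomputable def spectralRadius (T : RealTensor V k) : ℝ :=
  sSup T.eigenvalueModuli

end RealTensor

namespace Hypergraph

variable {V W : Type*}

/-- Every edge has exactly `k` vertices. -/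
def IsUniform (G : Hypergraph V) (k : ℕ) : Prop :=
  ∀ e ∈ G.edgeSet, e.encard = k

/-- The number of edges containing `v`. -/
noncomputable def degree (G : Hypergraph V) (v : V) : ℕ :=
  {e | e ∈ G.edgeSet ∧ v ∈ e}.ncard

/-- Any two vertices are joined by a walk in which consecutive vertices lie in a common edge. -/
def IsConnected (G : Hypergraph V) : Prop :=
  G.vertexSet.Nonempty ∧
    ∀ u ∈ G.vertexSet, ∀ v ∈ G.vertexSet, Relation.ReflTransGen G.Adj u v

/-- The cycles of `G`, each given by its set of vertices `v_i` and its set of edges `e_i`, where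
`i` runs cyclically through `ℤ/ℓ`, `ℓ ≥ 2`: the `v_i` are distinct, the `e_i` are distinct,
`{v_i, v_{i+1}} ⊆ e_i`, and edges that are not cyclically consecutive are disjoint. -/
def cycles (G : Hypergraph V) : Set (Set V × Set (Set V)) :=
  {c | ∃ l : ℕ, 2 ≤ l ∧ ∃ (v : ZMod l → V) (e : ZMod l → Set V),
    Function.Injective v ∧ Function.Injective e ∧
    (∀ i, e i ∈ G.edgeSet ∧ v i ∈ e i ∧ v (i + 1) ∈ e i) ∧
    (∀ i j, j ≠ i → j ≠ i + 1 → i ≠ j + 1 → Disjoint (e i) (e j)) ∧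
    c = (Set.range v, Set.range e)}

/-- Connected with exactly one cycle. -/
def IsUnicyclic (G : Hypergraph V) : Prop :=
  G.IsConnected ∧ ∃! c, c ∈ G.cycles

/-- Isomorphism: a bijection of the vertex sets that preserves and reflects edges. -/
def IsIsomorphic (G : Hypergraph V) (H : Hypergraph W) : Prop :=
  ∃ f : G.vertexSet ≃ H.vertexSet, ∀ e : Set G.vertexSet,
    Subtype.val '' e ∈ G.edgeSet ↔ Subtype.val '' (f '' e) ∈ H.edgeSet

/-- The `k`-th power of an `r`-uniform hypergraph, `r ≤ k`: each edge `e` is enlarged by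
`k - r` new vertices `v_{e,s}`, which belong to no other edge. -/
def power (G : Hypergraph V) (r k : ℕ) : Hypergraph (V ⊕ (G.edgeSet × Fin (k - r))) where
  vertexSet := Sum.inl '' G.vertexSet ∪ Set.range Sum.inr
  edgeSet := Set.range fun e : G.edgeSet =>
    Sum.inl '' (e : Set V) ∪ Set.range fun s : Fin (k - r) => Sum.inr (e, s)
  subset_vertexSet_of_mem_edgeSet' := by
    rintro _ ⟨e, rfl⟩
    refine Set.union_subset_union
      (Set.image_mono (G.subset_vertexSet_of_mem_edgeSet' e.2)) ?_
    rintro _ ⟨s, rfl⟩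
    exact ⟨_, rfl⟩

/-- `G` is (up to isomorphism) the `k`-th power of some ordinary finite graph, that is, of some
`2`-uniform hypergraph. -/
def IsPowerHypergraph (G : Hypergraph V) (k : ℕ) : Prop :=
  ∃ (n : ℕ) (H : Hypergraph (Fin n)), H.vertexSet = Set.univ ∧ H.IsUniform 2 ∧
    G.IsIsomorphic (H.power 2 k)

/-- For `m ≥ g ≥ 3`, the graph `U_{m,g}`: the cycle `0, 1, …, g - 1` together with `m - g` pendant
edges at the vertex `0`, whose other ends are `g, …, m - 1`. -/
def unicyclicU (m g : ℕ) : Hypergraph (Fin m) where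
  vertexSet := Set.univ
  edgeSet := {e | ∃ i j : Fin m, e = {i, j} ∧
    ((j.val = i.val + 1 ∧ j.val < g) ∨ (i.val = 0 ∧ j.val + 1 = g) ∨ (i.val = 0 ∧ g ≤ j.val))}
  subset_vertexSet_of_mem_edgeSet' := fun _ _ => Set.subset_univ _

section ABC

variable [Fintype V]

open Classical in
/-- The weight `((∑_{i ∈ e} d_i - k) / ∏_{i ∈ e} d_i)^{1/k}` of an edge `e`. -/
noncomputable def abcWeight (G : Hypergraph V) (k : ℕ) (e : Set V) : ℝ :=
  (((∑ i ∈ e.toFinset, (G.degree i : ℝ)) - k) / ∏ i ∈ e.toFinset, (G.degree i : ℝ))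
    ^ ((1 : ℝ) / k)

open Classical in
/-- The ABC tensor of a `k`-uniform hypergraph. -/
noncomputable def abcTensor (G : Hypergraph V) (k : ℕ) : RealTensor V k :=
  fun i t =>
    if insert i (Set.range t) ∈ G.edgeSet then
      1 / ((k - 1).factorial : ℝ) * G.abcWeight k (insert i (Set.range t))
    else 0

/-- The ABC spectral radius of a `k`-uniform hypergraph. -/
noncomputable def abcSpectralRadius (G : Hypergraph V) (k : ℕ) : ℝ :=
  (G.abcTensor k).spectralRadius

end ABC

end Hypergraph

/-- The cubic polynomial function
`t³ - (√2/2) t² - ((m² - 4m + 5)/(m - 1)) t + √2 (m² - 5m + 6)/(2 (m - 1))`. -/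
noncomputable def abcCubic (m : ℕ) (t : ℝ) : ℝ :=
  t ^ 3 - √2 / 2 * t ^ 2 - (((m : ℝ) ^ 2 - 4 * m + 5) / ((m : ℝ) - 1)) * t
    + √2 * ((m : ℝ) ^ 2 - 5 * m + 6) / (2 * ((m : ℝ) - 1))

/-! Only two features of a power hypergraph matter: two edges share at most one vertex (`IsLinear`),
and all but at most two vertices of an edge lie in no other edge (`HasCorePairs`). The argument
splits on whether some vertex lies in at least `m - 1` edges.

If such a vertex `c` exists, the structure is forced. By linearity the cycle has an edge `f` missing
`c`; all other edges contain `c`, and the two cycle neighbours of `f` close a triangle with it. So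
`G` is a triangle with pendant edges at `c`, that is `U_{m,3}^k` (`IsUnicyclic.exists_isSunCoding`).
Its spectral radius comes from an explicit positive eigenvector: the vertices of degree one can be
eliminated, which leaves the eigenvalue problem of the weighted graph `U_{m,3}` with eigenvalue `t`,
where `ρ = t^(2/k)` and `t` is a root of the cubic (`IsSunCoding.abcSpectralRadius_eq`).

Otherwise all degrees are at most `m - 2`. The AM-GM inequality bounds eigenvalues by means of a
labelling of incidences (`norm_le_of_labelling`), and a labelling built from `S(e) = ∑_{i ∈ e} (d_i
- 1)` gives `ρ^k ≤ M` as soon as `M` bounds all `d_u - 1` and the average of `S` over the edges at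
each `u` with `d_u ≥ 2` (`abcSpectralRadius_le_of_sum_le`). As there is only one cycle, at most one
edge avoiding `u` meets two edges at `u`, so the sum of `S` over the edges at `u` is at most `d_u² -
2d_u + m + 1`. This gives `M = m - 3 + 3/(m - 2)` for `m ≥ 5`; for `m = 4` one takes `M = 2`. The
cubic is negative at `√M`, hence `√M < a_m` and the inequality is strict. -/

namespace RealTensor

/-! ### Compactness of the set of eigenvalue moduli -/

variable {V : Type*} [Fintype V] {k : ℕ}

theorem apply_smul (T : RealTensor V k) (a : ℂ) (x : V → ℂ) (i : V) :
    T.apply (a • x) i = a ^ (k - 1) * T.apply x i := by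
  simp only [apply, Finset.mul_sum, Pi.smul_apply, smul_eq_mul, Finset.prod_mul_distrib,
    Finset.prod_const, Finset.card_univ, Fintype.card_fin]
  exact Finset.sum_congr rfl fun t _ => by ring

theorem IsEigenvalue.exists_norm_eq_one {T : RealTensor V k} {z : ℂ} (h : T.IsEigenvalue z) :
    ∃ x : V → ℂ, ‖x‖ = 1 ∧ ∀ i, T.apply x i = z * x i ^ (k - 1) := by
  obtain ⟨x, hx, he⟩ := h
  refine ⟨((‖x‖⁻¹ : ℝ) : ℂ) • x, ?_, fun i => ?_⟩
  · rw [norm_smul, Complex.norm_real, norm_inv, norm_norm,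
      inv_mul_cancel₀ (norm_ne_zero_iff.2 hx)]
  · rw [apply_smul, he, Pi.smul_apply, smul_eq_mul, mul_pow]
    ring

/-- Read the eigenvalue equation at a coordinate of largest modulus of a normalised eigenvector.
Only boundedness matters here, so the sum over all rows is good enough. -/
theorem IsEigenvalue.norm_le {T : RealTensor V k} {z : ℂ} (h : T.IsEigenvalue z) :
    ‖z‖ ≤ ∑ i, ∑ t, |T i t| := by
  obtain ⟨x, hx, he⟩ := h.exists_norm_eq_one
  have hne : Nonempty V := by
    by_contra hV
    rw [not_nonempty_iff] at hV
    rw [Subsingleton.elim x 0, norm_zero] at hx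
    exact zero_ne_one hx
  obtain ⟨i, hi⟩ := Finite.exists_max fun i => ‖x i‖
  have hxi : ‖x i‖ = 1 := by
    refine le_antisymm (hx ▸ norm_le_pi_norm x i) ?_
    rw [← hx]
    exact (pi_norm_le_iff_of_nonneg (norm_nonneg _)).2 hi
  calc ‖z‖ = ‖T.apply x i‖ := by rw [he, norm_mul, norm_pow, hxi, one_pow, mul_one]
    _ ≤ ∑ t, |T i t| := by
      refine norm_sum_le_of_le _ fun t _ => ?_
      rw [norm_mul, Complex.norm_real, Real.norm_eq_abs, norm_prod]
      exact mul_le_of_le_one_right (abs_nonneg _)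
        (Finset.prod_le_one (fun _ _ => norm_nonneg _) fun j _ => hx ▸ norm_le_pi_norm x _)
    _ ≤ ∑ i, ∑ t, |T i t| :=
      Finset.single_le_sum (f := fun i => ∑ t, |T i t|)
        (fun _ _ => Finset.sum_nonneg fun _ _ => abs_nonneg _) (Finset.mem_univ i)

/-- If a tensor has an eigenvalue at all, then the largest modulus is attained. -/
theorem isGreatest_spectralRadius {T : RealTensor V k} {z : ℂ} (h : T.IsEigenvalue z) :
    IsGreatest T.eigenvalueModuli T.spectralRadius := by
  -- Pairs of an eigenvalue and a normalised eigenvector form a closed bounded set, whose image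
  -- under the modulus is compact.
  set S : Set (ℂ × (V → ℂ)) :=
    {p | p ∈ Metric.closedBall (0 : ℂ) (∑ i, ∑ t, |T i t|) ×ˢ Metric.sphere (0 : V → ℂ) 1 ∧
      ∀ i, T.apply p.2 i = p.1 * p.2 i ^ (k - 1)} with hS
  have hcl : IsClosed {p : ℂ × (V → ℂ) | ∀ i, T.apply p.2 i = p.1 * p.2 i ^ (k - 1)} := by
    simp only [Set.ofPred_forall]
    refine isClosed_iInter fun i => isClosed_eq ?_ ?_
    · unfold apply
      fun_prop
    · fun_prop
  have hc : IsCompact S :=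
    ((isCompact_closedBall _ _).prod (isCompact_sphere _ _)).inter_right hcl
  have himg : T.eigenvalueModuli = (fun p : ℂ × (V → ℂ) => ‖p.1‖) '' S := by
    ext r
    constructor
    · rintro ⟨z, hz, rfl⟩
      obtain ⟨x, hx, he⟩ := hz.exists_norm_eq_one
      exact ⟨(z, x), ⟨⟨by simpa using hz.norm_le, by simpa using hx⟩, he⟩, rfl⟩
    · rintro ⟨⟨z, x⟩, ⟨⟨_, hx⟩, he⟩, rfl⟩
      refine ⟨z, ⟨x, ?_, he⟩, rfl⟩
      rintro rfl
      simp at hx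
  have hc' : IsCompact T.eigenvalueModuli :=
    himg ▸ hc.image (continuous_norm.comp continuous_fst)
  exact hc'.isGreatest_sSup ⟨_, z, h, rfl⟩

end RealTensor

/-! ### The ABC tensor as a sum over edges -/

namespace Hypergraph

variable {V : Type*} [Fintype V]

open Classical in
/-- The edges, as a finset of finsets. -/
noncomputable def edgeFinset (G : Hypergraph V) : Finset (Finset V) :=
  Finset.univ.filter fun e => (e : Set V) ∈ G.edgeSet

theorem mem_edgeFinset {G : Hypergraph V} {e : Finset V} :
    e ∈ G.edgeFinset ↔ (e : Set V) ∈ G.edgeSet := by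
  simp [edgeFinset]

theorem image_coe_edgeFinset (G : Hypergraph V) :
    ((↑) : Finset V → Set V) '' (G.edgeFinset : Set (Finset V)) = G.edgeSet := by
  ext e
  constructor
  · rintro ⟨e, he, rfl⟩
    exact mem_edgeFinset.1 he
  · intro he
    refine ⟨(Set.toFinite e).toFinset, ?_, by simp⟩
    simpa [mem_edgeFinset] using he

theorem ncard_edgeSet (G : Hypergraph V) : G.edgeSet.ncard = G.edgeFinset.card := by
  rw [← image_coe_edgeFinset, Set.ncard_image_of_injective _ Finset.coe_injective,
    Set.ncard_coe_finset]

theorem degree_eq_card [DecidableEq V] (G : Hypergraph V) (v : V) :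
    G.degree v = (G.edgeFinset.filter (v ∈ ·)).card := by
  rw [degree, ← Set.ncard_coe_finset, ← Set.ncard_image_of_injective _ Finset.coe_injective]
  congr 1
  ext e
  constructor
  · rintro ⟨he, hv⟩
    rw [← image_coe_edgeFinset] at he
    obtain ⟨e, he, rfl⟩ := he
    exact ⟨e, by simpa using ⟨he, hv⟩, rfl⟩
  · rintro ⟨e, he, rfl⟩
    simp only [Finset.coe_filter, Set.mem_ofPred_eq, mem_edgeFinset] at he
    exact he

theorem IsUniform.card_eq {G : Hypergraph V} {k : ℕ} (h : G.IsUniform k) {e : Finset V}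
    (he : e ∈ G.edgeFinset) : e.card = k := by
  have := h _ (mem_edgeFinset.1 he)
  rw [Set.encard_coe_eq_coe_finsetCard] at this
  exact_mod_cast this

theorem abcWeight_coe (G : Hypergraph V) (k : ℕ) (e : Finset V) :
    G.abcWeight k e = (((∑ i ∈ e, (G.degree i : ℝ)) - k) / ∏ i ∈ e, (G.degree i : ℝ))
      ^ ((1 : ℝ) / k) := by
  simp [abcWeight]

/-- A finset with `n` elements is the range of `n!` tuples of length `n`. -/
theorem card_filter_image_eq [DecidableEq V] (s : Finset V) (n : ℕ) (hs : s.card = n) :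
    (Finset.univ.filter fun t : Fin n → V => Finset.univ.image t = s).card = n.factorial := by
  have hcard : Fintype.card (Fin n) = Fintype.card s := by simp [hs]
  have key : Fintype.card (Fin n ≃ s) = n.factorial := by
    rw [Fintype.card_equiv (Fintype.equivOfCardEq hcard), Fintype.card_fin]
  rw [← key, ← Finset.card_univ]
  symm
  refine Finset.card_bij (fun g _ j => (g j : V)) ?_ ?_ ?_
  · intro g _
    simp only [Finset.mem_filter, Finset.mem_univ, true_and]
    ext v
    simp only [Finset.mem_image, Finset.mem_univ, true_and]
    constructor
    · rintro ⟨j, rfl⟩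
      exact (g j).2
    · intro hv
      exact ⟨g.symm ⟨v, hv⟩, by simp⟩
  · intro g _ g' _ h
    ext j
    exact congrFun h j
  · intro t ht
    simp only [Finset.mem_filter, Finset.mem_univ, true_and] at ht
    have hmem : ∀ j, t j ∈ s := fun j => ht ▸ Finset.mem_image_of_mem t (Finset.mem_univ j)
    have hsurj : Function.Surjective fun j => (⟨t j, hmem j⟩ : s) := by
      rintro ⟨v, hv⟩
      rw [← ht] at hv
      obtain ⟨j, _, hj⟩ := Finset.mem_image.1 hv
      exact ⟨j, Subtype.ext hj⟩
    exact ⟨Equiv.ofBijective _ ((Fintype.bijective_iff_surjective_and_card _).2 ⟨hsurj, hcard⟩),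
      Finset.mem_univ _, rfl⟩

/-- An edge `e` through `i` arises from exactly the `(k - 1)!` orderings of `e \ {i}`, which cancels
the factorial in the tensor. -/
theorem abcTensor_apply [DecidableEq V] {G : Hypergraph V} {k : ℕ}
    (hG : G.IsUniform k) (x : V → ℂ) (i : V) :
    (G.abcTensor k).apply x i =
      ∑ e ∈ G.edgeFinset with i ∈ e, (G.abcWeight k e : ℂ) * ∏ j ∈ e.erase i, x j := by
  have hcoe : ∀ t : Fin (k - 1) → V,
      insert i (Set.range t) = ((insert i (Finset.univ.image t) : Finset V) : Set V) := by
    intro t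
    simp
  have hmaps : ∀ t ∈ Finset.univ.filter (fun t : Fin (k - 1) → V =>
      insert i (Finset.univ.image t) ∈ G.edgeFinset),
      insert i (Finset.univ.image t) ∈ G.edgeFinset.filter (i ∈ ·) := by
    intro t ht
    simp only [Finset.mem_filter, Finset.mem_univ, true_and] at ht
    simp [ht]
  have h1 : (G.abcTensor k).apply x i = ∑ t : Fin (k - 1) → V with
      insert i (Finset.univ.image t) ∈ G.edgeFinset,
      (1 / ((k - 1).factorial : ℂ) * G.abcWeight k (insert i (Finset.univ.image t) : Finset V)) *
        ∏ j, x (t j) := by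
    rw [RealTensor.apply, Finset.sum_filter]
    refine Finset.sum_congr rfl fun t _ => ?_
    simp only [abcTensor]
    rw [hcoe]
    by_cases h : insert i (Finset.univ.image t) ∈ G.edgeFinset
    · rw [if_pos h, if_pos (mem_edgeFinset.1 h)]
      push_cast
      rfl
    · rw [if_neg h, if_neg fun h' => h (mem_edgeFinset.2 h')]
      simp
  rw [h1, ← Finset.sum_fiberwise_of_maps_to hmaps]
  refine Finset.sum_congr rfl fun e he => ?_
  rw [Finset.mem_filter] at he
  have hcard : (e.erase i).card = k - 1 := by
    rw [Finset.card_erase_of_mem he.2, hG.card_eq he.1]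
  have hiff : ∀ t : Fin (k - 1) → V,
      insert i (Finset.univ.image t) = e ↔ Finset.univ.image t = e.erase i := by
    intro t
    constructor
    · intro h
      have hle : (e.erase i) ⊆ Finset.univ.image t := by
        rw [← h]
        intro v hv
        rw [Finset.mem_erase, Finset.mem_insert] at hv
        tauto
      refine (Finset.eq_of_subset_of_card_le hle ?_).symm
      rw [hcard]
      exact Finset.card_image_le.trans (by simp)
    · intro h
      rw [h, Finset.insert_erase he.2]
  have hterm : ∀ t ∈ (Finset.univ.filter fun t : Fin (k - 1) → V =>
      Finset.univ.image t = e.erase i),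
      (1 / ((k - 1).factorial : ℂ) * G.abcWeight k (insert i (Finset.univ.image t) : Finset V)) *
        ∏ j, x (t j) =
      1 / ((k - 1).factorial : ℂ) * (G.abcWeight k e * ∏ j ∈ e.erase i, x j) := by
    intro t ht
    simp only [Finset.mem_filter, Finset.mem_univ, true_and] at ht
    rw [(hiff t).2 ht]
    have hinj : Set.InjOn t (Finset.univ : Finset (Fin (k - 1))) := by
      rw [← Finset.card_image_iff, ht, hcard]
      simp
    rw [← ht, Finset.prod_image hinj]
    ring
  have hset : (Finset.univ.filter fun t : Fin (k - 1) → V =>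
      insert i (Finset.univ.image t) ∈ G.edgeFinset).filter
        (fun t => insert i (Finset.univ.image t) = e) =
      Finset.univ.filter fun t : Fin (k - 1) → V => Finset.univ.image t = e.erase i := by
    ext t
    simp only [Finset.mem_filter, Finset.mem_univ, true_and, ← hiff]
    exact ⟨fun h => h.2, fun h => ⟨h ▸ he.1, h⟩⟩
  rw [hset, Finset.sum_congr rfl hterm, Finset.sum_const, card_filter_image_eq _ _ hcard,
    nsmul_eq_mul, ← mul_assoc, mul_one_div_cancel (Nat.cast_ne_zero.2 (Nat.factorial_ne_zero _)),
    one_mul]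

/-- For `k ≥ 3` the number `0` is an eigenvalue of the ABC tensor. -/
theorem isEigenvalue_zero {G : Hypergraph V} [Nonempty V] {k : ℕ} (hk : 3 ≤ k)
    (hG : G.IsUniform k) : (G.abcTensor k).IsEigenvalue 0 := by
  classical
  obtain ⟨v⟩ := ‹Nonempty V›
  -- Each product has `k - 1 ≥ 2` distinct indices, so one of them differs from `v`.
  refine ⟨Pi.single v 1, by simp, fun i => ?_⟩
  rw [abcTensor_apply hG, zero_mul]
  refine Finset.sum_eq_zero fun e he => ?_
  rw [Finset.mem_filter] at he
  have hcard : 1 < (e.erase i).card := by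
    rw [Finset.card_erase_of_mem he.2, hG.card_eq he.1]
    omega
  obtain ⟨j, hj, hjv⟩ := Finset.exists_mem_ne hcard v
  rw [Finset.prod_eq_zero hj (Pi.single_eq_of_ne hjv 1), mul_zero]

theorem isGreatest_abcSpectralRadius {G : Hypergraph V} [Nonempty V] {k : ℕ} (hk : 3 ≤ k)
    (hG : G.IsUniform k) :
    IsGreatest (G.abcTensor k).eigenvalueModuli (G.abcSpectralRadius k) :=
  RealTensor.isGreatest_spectralRadius (isEigenvalue_zero hk hG)

end Hypergraph

/-! ### Bounds from labellings and from positive eigenvectors -/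

namespace Hypergraph

variable {V : Type*} [Fintype V]

theorem one_le_degree {G : Hypergraph V} {e : Finset V} (he : e ∈ G.edgeFinset) {i : V}
    (hi : i ∈ e) : 1 ≤ G.degree i := by
  classical
  rw [degree_eq_card, Nat.one_le_iff_ne_zero, Finset.card_ne_zero]
  exact ⟨e, by simp [he, hi]⟩

theorem sum_degree_sub {G : Hypergraph V} {k : ℕ} (hG : G.IsUniform k) {e : Finset V}
    (he : e ∈ G.edgeFinset) :
    (∑ i ∈ e, (G.degree i : ℝ)) - k = ∑ i ∈ e, ((G.degree i : ℝ) - 1) := by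
  simp [Finset.sum_sub_distrib, hG.card_eq he]

theorem sum_degree_sub_one_nonneg {G : Hypergraph V} {e : Finset V} (he : e ∈ G.edgeFinset) :
    0 ≤ ∑ i ∈ e, ((G.degree i : ℝ) - 1) := by
  refine Finset.sum_nonneg fun i hi => ?_
  have : (1 : ℝ) ≤ G.degree i := by exact_mod_cast one_le_degree he hi
  linarith

theorem abcWeight_nonneg {G : Hypergraph V} {k : ℕ} (hG : G.IsUniform k) {e : Finset V}
    (he : e ∈ G.edgeFinset) : 0 ≤ G.abcWeight k e := by
  rw [abcWeight_coe, sum_degree_sub hG he]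
  exact Real.rpow_nonneg (div_nonneg (sum_degree_sub_one_nonneg he)
    (Finset.prod_nonneg fun _ _ => Nat.cast_nonneg _)) _

theorem abcWeight_pow {G : Hypergraph V} {k : ℕ} (hk : k ≠ 0) (hG : G.IsUniform k)
    {e : Finset V} (he : e ∈ G.edgeFinset) :
    G.abcWeight k e ^ k = (∑ i ∈ e, ((G.degree i : ℝ) - 1)) / ∏ i ∈ e, (G.degree i : ℝ) := by
  rw [abcWeight_coe, sum_degree_sub hG he, one_div]
  exact Real.rpow_inv_natCast_pow (div_nonneg (sum_degree_sub_one_nonneg he)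
    (Finset.prod_nonneg fun _ _ => Nat.cast_nonneg _)) hk

/-- The inequality of arithmetic and geometric means, with the root cleared. -/
theorem _root_.Finset.prod_le_sum_div_card_pow {ι : Type*} (s : Finset ι) (hs : s.Nonempty)
    (z : ι → ℝ) (hz : ∀ i ∈ s, 0 ≤ z i) :
    ∏ i ∈ s, z i ≤ ((∑ i ∈ s, z i) / s.card) ^ s.card := by
  have hc : (0 : ℝ) < s.card := by exact_mod_cast hs.card_pos
  have h := Real.geom_mean_le_arith_mean s (fun _ => (1 : ℝ)) z (by simp) (by simpa using hc) hz
  simp only [Real.rpow_one, Finset.sum_const, nsmul_eq_mul, mul_one, one_mul] at h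
  have hp : 0 ≤ ∏ i ∈ s, z i := Finset.prod_nonneg hz
  calc ∏ i ∈ s, z i = ((∏ i ∈ s, z i) ^ ((s.card : ℝ)⁻¹)) ^ s.card :=
        (Real.rpow_inv_natCast_pow hp hs.card_pos.ne').symm
    _ ≤ _ := pow_le_pow_left₀ (Real.rpow_nonneg hp _) h _

/-- A nonnegative labelling of the incidences whose sum at every vertex is at most `1`, and whose
product over every edge `e` is at least `(w_e / r)^k`, bounds the eigenvalues by `r`. -/
theorem norm_le_of_labelling [DecidableEq V] {G : Hypergraph V} {k : ℕ} (hk : 1 ≤ k)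
    (hG : G.IsUniform k) {r : ℝ} (hr : 0 ≤ r) (B : V → Finset V → ℝ) (hB : ∀ i, ∀ e ∈ G.edgeFinset, 0 ≤ B i e)
    (hsum : ∀ i, ∑ e ∈ G.edgeFinset with i ∈ e, B i e ≤ 1)
    (hprod : ∀ e ∈ G.edgeFinset, G.abcWeight k e ^ k ≤ r ^ k * ∏ i ∈ e, B i e)
    {z : ℂ} (hz : (G.abcTensor k).IsEigenvalue z) : ‖z‖ ≤ r := by
  obtain ⟨x, hx, he⟩ := hz
  have hk0 : (0 : ℝ) < k := by exact_mod_cast hk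
  have hpos : 0 < ∑ i, ‖x i‖ ^ k := by
    obtain ⟨i, hi⟩ := Function.ne_iff.1 hx
    exact Finset.sum_pos' (fun _ _ => by positivity)
      ⟨i, Finset.mem_univ _, pow_pos (norm_pos_iff.2 hi) _⟩
  -- The eigenvalue equation at `i` is multiplied by `‖x i‖`, so that every edge contributes its
  -- full product.
  have hlocal : ∀ i, ‖z‖ * ‖x i‖ ^ k ≤
      ∑ e ∈ G.edgeFinset with i ∈ e, G.abcWeight k e * ∏ j ∈ e, ‖x j‖ := by
    intro i
    have h1 : ‖z‖ * ‖x i‖ ^ (k - 1) ≤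
        ∑ e ∈ G.edgeFinset with i ∈ e, G.abcWeight k e * ∏ j ∈ e.erase i, ‖x j‖ := by
      rw [← norm_pow, ← norm_mul, ← he i, abcTensor_apply hG]
      refine norm_sum_le_of_le _ fun e h => ?_
      rw [norm_mul, norm_prod, Complex.norm_real, Real.norm_of_nonneg
        (abcWeight_nonneg hG (Finset.mem_filter.1 h).1)]
    calc ‖z‖ * ‖x i‖ ^ k = (‖z‖ * ‖x i‖ ^ (k - 1)) * ‖x i‖ := by
          rw [mul_assoc, ← pow_succ, Nat.sub_add_cancel hk]
      _ ≤ _ := mul_le_mul_of_nonneg_right h1 (norm_nonneg _)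
      _ = _ := by
        rw [Finset.sum_mul]
        refine Finset.sum_congr rfl fun e h => ?_
        rw [mul_assoc, Finset.prod_erase_mul _ _ (Finset.mem_filter.1 h).2]
  -- AM-GM for the `k` numbers `B i e * ‖x i‖ ^ k`; the product condition on `B` absorbs the weight.
  have hedge : ∀ e ∈ G.edgeFinset, k * (G.abcWeight k e * ∏ j ∈ e, ‖x j‖) ≤
      r * ∑ i ∈ e, B i e * ‖x i‖ ^ k := by
    intro e h
    have hcard := hG.card_eq h
    have hne : e.Nonempty := Finset.card_pos.1 (by omega)
    have hnn : ∀ i ∈ e, 0 ≤ B i e * ‖x i‖ ^ k := fun i _ => mul_nonneg (hB i e h) (by positivity)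
    have hS : 0 ≤ ∑ i ∈ e, B i e * ‖x i‖ ^ k := Finset.sum_nonneg hnn
    have hamgm := Finset.prod_le_sum_div_card_pow e hne _ hnn
    rw [hcard] at hamgm
    have hpow : (G.abcWeight k e * ∏ j ∈ e, ‖x j‖) ^ k ≤
        (r * ((∑ i ∈ e, B i e * ‖x i‖ ^ k) / k)) ^ k := by
      rw [mul_pow, mul_pow, ← Finset.prod_pow]
      calc _ ≤ (r ^ k * ∏ i ∈ e, B i e) * ∏ i ∈ e, ‖x i‖ ^ k :=
            mul_le_mul_of_nonneg_right (hprod e h) (Finset.prod_nonneg fun _ _ => by positivity)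
        _ = r ^ k * ∏ i ∈ e, B i e * ‖x i‖ ^ k := by rw [Finset.prod_mul_distrib, mul_assoc]
        _ ≤ _ := mul_le_mul_of_nonneg_left hamgm (by positivity)
    have hle := le_of_pow_le_pow_left₀ (by omega) (by positivity) hpow
    calc _ ≤ k * (r * ((∑ i ∈ e, B i e * ‖x i‖ ^ k) / k)) :=
          mul_le_mul_of_nonneg_left hle hk0.le
      _ = _ := by field_simp
  have hswap : ∀ f : V → Finset V → ℝ,
      ∑ i, ∑ e ∈ G.edgeFinset with i ∈ e, f i e = ∑ e ∈ G.edgeFinset, ∑ i ∈ e, f i e := by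
    intro f
    exact Finset.sum_comm' (by simp [and_comm])
  have hfinal : ‖z‖ * ∑ i, ‖x i‖ ^ k ≤ r * ∑ i, ‖x i‖ ^ k := by
    calc ‖z‖ * ∑ i, ‖x i‖ ^ k
        ≤ ∑ i, ∑ e ∈ G.edgeFinset with i ∈ e, G.abcWeight k e * ∏ j ∈ e, ‖x j‖ := by
          rw [Finset.mul_sum]
          exact Finset.sum_le_sum fun i _ => hlocal i
      _ = ∑ e ∈ G.edgeFinset, k * (G.abcWeight k e * ∏ j ∈ e, ‖x j‖) := by
          rw [hswap fun _ e => G.abcWeight k e * ∏ j ∈ e, ‖x j‖]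
          refine Finset.sum_congr rfl fun e h => ?_
          rw [Finset.sum_const, nsmul_eq_mul, hG.card_eq h]
      _ ≤ ∑ e ∈ G.edgeFinset, r * ∑ i ∈ e, B i e * ‖x i‖ ^ k := Finset.sum_le_sum hedge
      _ = r * ∑ i, (∑ e ∈ G.edgeFinset with i ∈ e, B i e) * ‖x i‖ ^ k := by
          simp only [Finset.sum_mul]
          rw [hswap fun i e => B i e * ‖x i‖ ^ k, Finset.mul_sum]
      _ ≤ r * ∑ i, ‖x i‖ ^ k := by
          refine mul_le_mul_of_nonneg_left (Finset.sum_le_sum fun i _ => ?_) hr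
          exact mul_le_of_le_one_left (by positivity) (hsum i)
  exact le_of_mul_le_mul_right hfinal hpos

theorem abcSpectralRadius_le_of_labelling [DecidableEq V] [Nonempty V] {G : Hypergraph V} {k : ℕ}
    (hk : 3 ≤ k) (hG : G.IsUniform k) {r : ℝ} (hr : 0 ≤ r) (B : V → Finset V → ℝ)
    (hB : ∀ i, ∀ e ∈ G.edgeFinset, 0 ≤ B i e) (hsum : ∀ i, ∑ e ∈ G.edgeFinset with i ∈ e, B i e ≤ 1)
    (hprod : ∀ e ∈ G.edgeFinset, G.abcWeight k e ^ k ≤ r ^ k * ∏ i ∈ e, B i e) :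
    G.abcSpectralRadius k ≤ r := by
  obtain ⟨z, hz, h⟩ := (isGreatest_abcSpectralRadius hk hG).1
  rw [h]
  exact norm_le_of_labelling (by omega) hG hr B hB hsum hprod hz

/-- A positive eigenvector, given by the `k`-th powers `y` of its entries and by the shares `Z e`
that the edges contribute to the eigenvalue equations, determines the spectral radius. -/
theorem abcSpectralRadius_eq_of_pos [DecidableEq V] [Nonempty V] {G : Hypergraph V} {k : ℕ}
    (hk : 3 ≤ k) (hG : G.IsUniform k) {r : ℝ} (hr : 0 < r) (y : V → ℝ) (hy : ∀ i, 0 < y i)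
    (Z : Finset V → ℝ) (hZ : ∀ e ∈ G.edgeFinset, 0 < Z e)
    (hsum : ∀ i, ∑ e ∈ G.edgeFinset with i ∈ e, Z e = y i)
    (hprod : ∀ e ∈ G.edgeFinset, G.abcWeight k e ^ k * ∏ i ∈ e, y i = r ^ k * Z e ^ k) :
    G.abcSpectralRadius k = r := by
  have hk0 : k ≠ 0 := by omega
  refine le_antisymm ?_ ?_
  -- The label is the share of `e` in the equation at `i`; the sum condition and the product
  -- condition then both hold with equality.
  · refine abcSpectralRadius_le_of_labelling hk hG hr.le (fun i e => Z e / y i)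
      (fun i e he => (div_pos (hZ e he) (hy i)).le) (fun i => ?_) (fun e he => ?_)
    · rw [← Finset.sum_div, hsum, div_self (hy i).ne']
    · have hp : 0 < ∏ i ∈ e, y i := Finset.prod_pos fun i _ => hy i
      rw [Finset.prod_div_distrib, Finset.prod_const, hG.card_eq he, ← mul_div_assoc,
        le_div_iff₀ hp, hprod e he]
  · set X : V → ℝ := fun i => y i ^ ((k : ℝ)⁻¹) with hX
    have hXpos : ∀ i, 0 < X i := fun i => Real.rpow_pos_of_pos (hy i) _
    have hXpow : ∀ i, X i ^ k = y i := fun i => Real.rpow_inv_natCast_pow (hy i).le hk0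
    have hedge : ∀ e ∈ G.edgeFinset, G.abcWeight k e * ∏ i ∈ e, X i = r * Z e := by
      intro e he
      refine (pow_left_inj₀ (mul_nonneg (abcWeight_nonneg hG he)
        (Finset.prod_nonneg fun i _ => (hXpos i).le)) (mul_pos hr (hZ e he)).le hk0).1 ?_
      rw [mul_pow, mul_pow, ← Finset.prod_pow, Finset.prod_congr rfl fun i _ => hXpow i,
        hprod e he]
    have heig : (G.abcTensor k).IsEigenvalue (r : ℂ) := by
      refine ⟨fun i => (X i : ℂ), ?_, fun i => ?_⟩
      · obtain ⟨v⟩ := ‹Nonempty V›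
        exact Function.ne_iff.2 ⟨v, by simpa using (hXpos v).ne'⟩
      · rw [abcTensor_apply hG]
        have hreal : ∑ e ∈ G.edgeFinset with i ∈ e, G.abcWeight k e * ∏ j ∈ e.erase i, X j =
            r * X i ^ (k - 1) := by
          refine mul_right_cancel₀ (hXpos i).ne' ?_
          rw [mul_assoc, ← pow_succ, Nat.sub_add_cancel (by omega), hXpow, Finset.sum_mul, ← hsum,
            Finset.mul_sum]
          refine Finset.sum_congr rfl fun e h => ?_
          rw [Finset.mem_filter] at h
          rw [mul_assoc, Finset.prod_erase_mul _ _ h.2, hedge e h.1]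
        have hcast := congrArg ((↑) : ℝ → ℂ) hreal
        push_cast at hcast
        exact hcast
    exact (isGreatest_abcSpectralRadius hk hG).2 ⟨r, heig, by
      rw [Complex.norm_real, Real.norm_of_nonneg hr.le]⟩

end Hypergraph

/-! ### The cubic and its largest root -/

theorem abcCubic_eq {m : ℕ} (hm : 3 ≤ m) (t : ℝ) :
    abcCubic m t = (t ^ 2 - ((m : ℝ) - 2) * (m - 3) / (m - 1)) * (t - √2 / 2) - t := by
  have h : (m : ℝ) - 1 ≠ 0 := by
    have : (3 : ℝ) ≤ m := by exact_mod_cast hm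
    linarith
  unfold abcCubic
  field_simp
  ring

theorem sqrt_two_bounds : 1 < √2 ∧ √2 < 3 / 2 := by
  constructor
  · rw [Real.lt_sqrt] <;> norm_num
  · rw [Real.sqrt_lt'] <;> norm_num

/-- For `t ≥ m` the two factors in `abcCubic_eq` are at least `2 * t` and `2`, so their product
exceeds `t`. This bounds the roots from above. -/
theorem abcCubic_pos {m : ℕ} (hm : 3 ≤ m) {t : ℝ} (ht : (m : ℝ) ≤ t) : 0 < abcCubic m t := by
  have h3 : (3 : ℝ) ≤ m := by exact_mod_cast hm
  have hs := sqrt_two_bounds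
  have hc : ((m : ℝ) - 2) * (m - 3) / (m - 1) ≤ m := by
    rw [div_le_iff₀ (by linarith)]
    nlinarith
  rw [abcCubic_eq hm]
  nlinarith [mul_nonneg (show 0 ≤ t ^ 2 - ((m : ℝ) - 2) * (m - 3) / (m - 1) - 2 * t by nlinarith)
    (show 0 ≤ t - √2 / 2 - 2 by linarith)]

theorem abcCubic_sqrt_two_div_two_neg {m : ℕ} (hm : 3 ≤ m) : abcCubic m (√2 / 2) < 0 := by
  rw [abcCubic_eq hm, sub_self, mul_zero, zero_sub]
  have := sqrt_two_bounds
  linarith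

/-- The cubic has a largest root, which exceeds every point where the cubic is negative. -/
theorem exists_isGreatest_abcCubic {m : ℕ} (hm : 3 ≤ m) :
    ∃ a : ℝ, IsGreatest {t : ℝ | abcCubic m t = 0} a ∧ ∀ s, abcCubic m s < 0 → s < a := by
  have hcont : Continuous (abcCubic m) := by
    unfold abcCubic
    fun_prop
  have hbdd : BddAbove {t : ℝ | abcCubic m t = 0} := by
    refine ⟨m, fun t (ht : abcCubic m t = 0) => ?_⟩
    by_contra! h
    exact (abcCubic_pos hm h.le).ne' ht
  have hroot : ∀ s, abcCubic m s < 0 → ∃ t, s < t ∧ abcCubic m t = 0 := by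
    intro s hs
    have hsm : s ≤ m := by
      by_contra! h
      exact (abcCubic_pos hm h.le).not_gt hs
    obtain ⟨t, ht, h0⟩ := intermediate_value_Icc hsm hcont.continuousOn
      ⟨hs.le, (abcCubic_pos hm le_rfl).le⟩
    refine ⟨t, lt_of_le_of_ne ht.1 ?_, h0⟩
    rintro rfl
    exact hs.ne h0
  obtain ⟨t, _, ht⟩ := hroot _ (abcCubic_sqrt_two_div_two_neg hm)
  have hmem := (isClosed_singleton (x := (0 : ℝ))).preimage hcont |>.csSup_mem ⟨t, ht⟩ hbdd
  refine ⟨_, ⟨hmem, fun t ht => le_csSup hbdd ht⟩, fun s hs => ?_⟩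
  obtain ⟨t, hst, ht⟩ := hroot s hs
  exact hst.trans_le (le_csSup hbdd ht)

theorem abcCubic_four_sqrt_two_neg : abcCubic 4 √2 < 0 := by
  rw [abcCubic_eq (by norm_num)]
  have := sqrt_two_bounds
  norm_num
  linarith

/-- The point is `√M` for the bound `M` available when all degrees are at most `m - 2`. With `1 + d`
the value of the quadratic factor there, the claim reads `d * √M < (1 + d) * (√2 / 2)`. After
squaring and substituting `m = n + 5`, the difference of the two sides has only positive
coefficients. -/
theorem abcCubic_sqrt_neg {m : ℕ} (hm : 5 ≤ m) :
    abcCubic m √((m : ℝ) - 3 + 3 / (m - 2)) < 0 := by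
  obtain ⟨n, rfl⟩ := Nat.exists_eq_add_of_le' hm
  have hn : (0 : ℝ) ≤ n := Nat.cast_nonneg n
  rw [abcCubic_eq (by omega)]
  push_cast
  set B : ℝ := (n : ℝ) + 5 - 3 + 3 / (n + 5 - 2) with hB
  have hB0 : 0 ≤ B := by
    have : 0 ≤ 3 / ((n : ℝ) + 5 - 2) := div_nonneg (by norm_num) (by linarith)
    rw [hB]
    linarith
  have hsq : √B ^ 2 = B := Real.sq_sqrt hB0
  have h2 : √2 ^ 2 = 2 := Real.sq_sqrt (by norm_num)
  set d : ℝ := (n + 6) / ((n + 4) * (n + 3)) with hd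
  have hd0 : 0 < d := by positivity
  have hBc : B - (((n : ℝ) + 5) - 2) * ((n + 5) - 3) / ((n + 5) - 1) = 1 + d := by
    rw [hB, hd]
    have h1 : (n : ℝ) + 5 - 2 = n + 3 := by ring
    have h2 : (n : ℝ) + 5 - 1 = n + 4 := by ring
    rw [h1, h2]
    field_simp
    ring
  rw [hsq, hBc]
  have hlt : d * √B < (1 + d) * (√2 / 2) := by
    refine lt_of_pow_lt_pow_left₀ 2 (by positivity) ?_
    rw [mul_pow, mul_pow, div_pow √2, hsq, h2, hB, hd]
    have h1 : (n : ℝ) + 5 - 2 = n + 3 := by ring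
    rw [h1, ← sub_pos]
    have : (1 + ((n : ℝ) + 6) / ((n + 4) * (n + 3))) ^ 2 * (2 / 2 ^ 2) -
        (((n : ℝ) + 6) / ((n + 4) * (n + 3))) ^ 2 * (n + 5 - 3 + 3 / (n + 3)) =
        (n ^ 5 + 17 * n ^ 4 + 114 * n ^ 3 + 378 * n ^ 2 + 612 * n + 324) /
          (2 * ((n + 4) ^ 2 * (n + 3) ^ 3)) := by
      field_simp
      ring
    rw [this]
    positivity
  linarith [show (1 + d) * (√B - √2 / 2) = (1 + d) * √B - (1 + d) * (√2 / 2) by ring,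
    show (1 + d) * √B = √B + d * √B by ring]

/-! ### Copies of the power of `U_{m,3}`, described by codes -/

namespace Hypergraph

/-- The incidence of the `k`-th power of `U_{m,3}`: the codes `inl 0`, `inl 1`, `inl 2` stand for
the vertices of the triangle, `inr j` for the vertices of degree `1` in the edge `j`; the edge `0`
is the one opposite to `inl 0`, the edges `1`, `2` are the others of the triangle. -/
def SunIncident (m : ℕ) : Fin 3 ⊕ Fin m → Fin m → Prop
  | .inl a, j => (a = 0 ∧ j.val ≠ 0) ∨ (a ≠ 0 ∧ (j.val = 0 ∨ j.val = a.val))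
  | .inr i, j => i = j

/-- The coding `κ` exhibits `G` as a copy of the `k`-th power of `U_{m,3}`. -/
structure IsSunCoding {V : Type*} (G : Hypergraph V) (m k : ℕ) (κ : V → Fin 3 ⊕ Fin m) :
    Prop where
  edgeSet_eq : G.edgeSet = Set.range fun j => {v | SunIncident m (κ v) j}
  card_inl : ∀ a, Nat.card {v // κ v = .inl a} = 1
  card_inr : ∀ j, Nat.card {v // κ v = .inr j} = if j.val < 3 then k - 2 else k - 1

/-- The sizes of the code classes are prescribed, so equal codes can be matched class by class.
Incidence depends on the codes alone, hence such a matching is an isomorphism. -/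
theorem IsSunCoding.nonempty_equiv {V W : Type*} [Finite V] [Finite W] {G : Hypergraph V}
    {H : Hypergraph W} {m k : ℕ}
    {κ : V → Fin 3 ⊕ Fin m} {μ : W → Fin 3 ⊕ Fin m} (hκ : G.IsSunCoding m k κ)
    (hμ : H.IsSunCoding m k μ) : ∃ φ : V ≃ W, ∀ v, μ (φ v) = κ v := by
  have h : ∀ c, Nonempty ({v // κ v = c} ≃ {w // μ w = c}) := by
    intro c
    refine Finite.card_eq.1 ?_
    cases c with
    | inl a => rw [hκ.card_inl, hμ.card_inl]
    | inr j => rw [hκ.card_inr, hμ.card_inr]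
  exact ⟨Equiv.ofFiberEquiv fun c => (h c).some, fun v => Equiv.ofFiberEquiv_map _ v⟩

theorem isIsomorphic_of_equiv {V W : Type*} {G : Hypergraph V} {H : Hypergraph W}
    (hG : G.vertexSet = Set.univ) (hH : H.vertexSet = Set.univ) (φ : V ≃ W)
    (hφ : ∀ e, e ∈ G.edgeSet ↔ φ '' e ∈ H.edgeSet) : G.IsIsomorphic H := by
  refine ⟨φ.subtypeEquiv fun v => by simp [hG, hH], fun e => ?_⟩
  rw [hφ, Set.image_image, Set.image_image]
  rfl

theorem IsIsomorphic.exists_equiv {V W : Type*} {G : Hypergraph V} {H : Hypergraph W}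
    (hG : G.vertexSet = Set.univ) (hH : H.vertexSet = Set.univ) (h : G.IsIsomorphic H) :
    ∃ φ : V ≃ W, ∀ e, e ∈ G.edgeSet ↔ φ '' e ∈ H.edgeSet := by
  obtain ⟨f, hf⟩ := h
  refine ⟨(Equiv.Set.univ V).symm.trans ((Equiv.setCongr hG.symm).trans (f.trans
    ((Equiv.setCongr hH).trans (Equiv.Set.univ W)))), fun e => ?_⟩
  have hpre : Subtype.val '' (Subtype.val ⁻¹' e : Set G.vertexSet) = e := by
    rw [Subtype.image_preimage_coe, hG, Set.univ_inter]
  have := hf (Subtype.val ⁻¹' e)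
  rw [hpre] at this
  rw [this]
  congr! 1
  ext w
  constructor
  · rintro ⟨_, ⟨⟨v, hv⟩, hve, rfl⟩, rfl⟩
    exact ⟨v, hve, rfl⟩
  · rintro ⟨v, hve, rfl⟩
    exact ⟨f ⟨v, by simp [hG]⟩, ⟨_, hve, rfl⟩, rfl⟩

theorem IsSunCoding.isIsomorphic {V W : Type*} [Finite V] [Finite W] {G : Hypergraph V}
    {H : Hypergraph W} {m k : ℕ}
    {κ : V → Fin 3 ⊕ Fin m} {μ : W → Fin 3 ⊕ Fin m} (hG : G.vertexSet = Set.univ)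
    (hH : H.vertexSet = Set.univ) (hκ : G.IsSunCoding m k κ)
    (hμ : H.IsSunCoding m k μ) : G.IsIsomorphic H := by
  obtain ⟨φ, hφ⟩ := hκ.nonempty_equiv hμ
  refine isIsomorphic_of_equiv hG hH φ fun e => ?_
  rw [hκ.edgeSet_eq, hμ.edgeSet_eq, Set.mem_range, Set.mem_range]
  refine exists_congr fun j => ?_
  rw [φ.eq_image_iff_symm_image_eq, Equiv.image_symm_eq_preimage]
  simp [hφ, Set.preimage]

theorem IsSunCoding.of_isIsomorphic {V W : Type*} {G : Hypergraph V}
    {H : Hypergraph W} {m k : ℕ} {μ : W → Fin 3 ⊕ Fin m} (hG : G.vertexSet = Set.univ)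
    (hH : H.vertexSet = Set.univ) (h : G.IsIsomorphic H) (hμ : H.IsSunCoding m k μ) :
    ∃ κ, G.IsSunCoding m k κ := by
  obtain ⟨φ, hφ⟩ := h.exists_equiv hG hH
  refine ⟨μ ∘ φ, ?_, fun a => ?_, fun j => ?_⟩
  · ext e
    rw [hφ, hμ.edgeSet_eq, Set.mem_range, Set.mem_range]
    refine exists_congr fun j => ?_
    rw [φ.eq_image_iff_symm_image_eq, Equiv.image_symm_eq_preimage]
    simp [Set.preimage]
  · rw [← hμ.card_inl a]
    exact Nat.card_congr (φ.subtypeEquiv fun v => Iff.rfl)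
  · rw [← hμ.card_inr j]
    exact Nat.card_congr (φ.subtypeEquiv fun v => Iff.rfl)

namespace IsSunCoding

variable {V : Type*} [Fintype V] {G : Hypergraph V} {m k : ℕ} {κ : V → Fin 3 ⊕ Fin m}

open Classical in
/-- The edge with a given index. -/
noncomputable def edge (κ : V → Fin 3 ⊕ Fin m) (j : Fin m) : Finset V :=
  Finset.univ.filter fun v => SunIncident m (κ v) j

theorem mem_edge {v : V} {j : Fin m} : v ∈ edge κ j ↔ SunIncident m (κ v) j := by
  simp [edge]

/-- As `k ≥ 3`, every edge has a vertex of degree one, which identifies it. -/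
theorem edge_injective (hk : 3 ≤ k) (hκ : G.IsSunCoding m k κ) :
    Function.Injective (edge κ) := by
  intro i j h
  have hc : Nat.card {v // κ v = .inr i} ≠ 0 := by
    rw [hκ.card_inr]
    split_ifs <;> omega
  obtain ⟨⟨v, hv⟩⟩ := (Nat.card_ne_zero.1 hc).1
  have hi : v ∈ edge κ i := by
    rw [mem_edge, hv]
    exact rfl
  rw [h, mem_edge, hv] at hi
  exact hi

theorem edgeFinset_eq [DecidableEq V] (hκ : G.IsSunCoding m k κ) :
    G.edgeFinset = Finset.univ.image (edge κ) := by
  ext e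
  simp only [mem_edgeFinset, hκ.edgeSet_eq, Set.mem_range, Finset.mem_image, Finset.mem_univ,
    true_and]
  refine exists_congr fun j => ?_
  rw [← Finset.coe_inj]
  simp [edge]

open Classical in
theorem sum_edgeFinset_filter (hk : 3 ≤ k) (hκ : G.IsSunCoding m k κ) {M : Type*}
    [AddCommMonoid M] (v : V) (F : Finset V → M) :
    ∑ e ∈ G.edgeFinset with v ∈ e, F e =
      ∑ j, if SunIncident m (κ v) j then F (edge κ j) else 0 := by
  rw [Finset.sum_filter, hκ.edgeFinset_eq, Finset.sum_image fun _ _ _ _ h => edge_injective hk hκ h]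
  simp only [mem_edge]

-- The vertices of the edge are grouped by code. The exponent is `k - 1` on a pendant edge because
-- its free end counts among the vertices of degree one.
open Classical in
theorem prod_edge (hκ : G.IsSunCoding m k κ) {M : Type*} [CommMonoid M] (g : Fin 3 ⊕ Fin m → M)
    (j : Fin m) :
    ∏ v ∈ edge κ j, g (κ v) = (∏ a, if SunIncident m (.inl a) j then g (.inl a) else 1) *
      g (.inr j) ^ (if j.val < 3 then k - 2 else k - 1) := by
  have hfib : ∀ c, ∏ v with κ v = c, (if SunIncident m (κ v) j then g (κ v) else 1) =
      (if SunIncident m c j then g c else 1) ^ Nat.card {v // κ v = c} := by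
    intro c
    rw [Nat.card_eq_fintype_card, Fintype.card_subtype, ← Finset.prod_const]
    refine Finset.prod_congr rfl fun v hv => ?_
    rw [(Finset.mem_filter.1 hv).2]
  rw [edge, Finset.prod_filter, ← Finset.prod_fiberwise _ κ, Finset.prod_congr rfl
    fun c _ => hfib c, Fintype.prod_sum_type]
  congr 1
  · refine Finset.prod_congr rfl fun a _ => ?_
    rw [hκ.card_inl, pow_one]
  · rw [Finset.prod_eq_single j]
    · rw [hκ.card_inr, if_pos (show SunIncident m (.inr j) j from rfl)]
    · intro i _ hij
      rw [if_neg (show ¬SunIncident m (.inr i) j from hij), one_pow]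
    · simp

theorem sum_edge (hκ : G.IsSunCoding m k κ) {M : Type*} [AddCommMonoid M]
    (g : Fin 3 ⊕ Fin m → M) (j : Fin m) [∀ a, Decidable (SunIncident m (.inl a) j)] :
    ∑ v ∈ edge κ j, g (κ v) = (∑ a, if SunIncident m (.inl a) j then g (.inl a) else 0) +
      (if j.val < 3 then k - 2 else k - 1) • g (.inr j) := by
  classical
  have := hκ.prod_edge (M := Multiplicative M) (fun c => Multiplicative.ofAdd (g c)) j
  apply Multiplicative.ofAdd.injective
  rw [ofAdd_add, ofAdd_nsmul, ofAdd_sum, this, ofAdd_sum]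
  congr 1
  refine Finset.prod_congr rfl fun a _ => ?_
  split_ifs <;> rfl

/-- The degrees, in terms of the codes. -/
def codeDegree (m : ℕ) : Fin 3 ⊕ Fin m → ℕ
  | .inl a => if a = 0 then m - 1 else 2
  | .inr _ => 1

theorem degree_eq (hk : 3 ≤ k) (hm : 3 ≤ m) (hκ : G.IsSunCoding m k κ) (v : V) :
    G.degree v = codeDegree m (κ v) := by
  classical
  rw [degree_eq_card, Finset.card_eq_sum_ones, hκ.sum_edgeFinset_filter hk]
  obtain ⟨n, rfl⟩ := Nat.exists_eq_add_of_le' hm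
  rcases κ v with a | i
  · rw [Fin.sum_univ_succ, Fin.sum_univ_succ, Fin.sum_univ_succ]
    simp only [SunIncident, Fin.val_succ, Fin.val_zero]
    fin_cases a <;> simp [codeDegree]
    omega
  · rw [Finset.sum_eq_single i]
    · exact if_pos rfl
    · intro j _ hj
      exact if_neg fun h : i = j => hj h.symm
    · simp

end IsSunCoding
end Hypergraph

/-! ### The spectral radius of the power of `U_{m,3}` -/

namespace Hypergraph

theorem sunIncident_inl_zero {m : ℕ} {j : Fin m} :
    SunIncident m (.inl 0) j ↔ j.val ≠ 0 := by
  simp [SunIncident]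

theorem sunIncident_inl_one {m : ℕ} {j : Fin m} :
    SunIncident m (.inl 1) j ↔ j.val = 0 ∨ j.val = 1 := by
  simp [SunIncident]

theorem sunIncident_inl_two {m : ℕ} {j : Fin m} :
    SunIncident m (.inl 2) j ↔ j.val = 0 ∨ j.val = 2 := by
  simp [SunIncident]

namespace IsSunCoding

variable {V : Type*} [Fintype V] {G : Hypergraph V} {m k : ℕ} {κ : V → Fin 3 ⊕ Fin m}

theorem abcWeight_edge_pow (hk : 3 ≤ k) (hm : 3 ≤ m) (hG : G.IsUniform k)
    (hκ : G.IsSunCoding m k κ) (j : Fin m) :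
    G.abcWeight k (edge κ j) ^ k =
      if j.val < 3 then 1 / 2 else ((m : ℝ) - 2) / (m - 1) := by
  classical
  have he : edge κ j ∈ G.edgeFinset := by
    rw [hκ.edgeFinset_eq]
    exact Finset.mem_image_of_mem _ (Finset.mem_univ _)
  have h3 : (3 : ℝ) ≤ m := by exact_mod_cast hm
  have hm1 : (m : ℝ) - 1 ≠ 0 := by linarith
  have hcast : ((m - 1 : ℕ) : ℝ) = m - 1 := by
    rw [Nat.cast_sub (by omega), Nat.cast_one]
  rw [abcWeight_pow (by omega) hG he]
  simp only [hκ.degree_eq hk hm]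
  rw [hκ.sum_edge (fun c => (codeDegree m c : ℝ) - 1),
    hκ.prod_edge (fun c => (codeDegree m c : ℝ)), Fin.sum_univ_three, Fin.prod_univ_three]
  simp only [sunIncident_inl_zero, sunIncident_inl_one, sunIncident_inl_two, codeDegree,
    Nat.cast_one, sub_self, smul_zero, add_zero, one_pow, mul_one, if_true, hcast,
    show (1 : Fin 3) ≠ 0 by decide, show (2 : Fin 3) ≠ 0 by decide, if_false]
  rcases (by omega : j.val = 0 ∨ j.val = 1 ∨ j.val = 2 ∨ 3 ≤ j.val) with h | h | h | h
  · simp [h]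
    norm_num
  · simp [h]
    field_simp
    ring
  · simp [h]
    field_simp
    ring
  · simp [show j.val ≠ 0 by omega, show j.val ≠ 1 by omega, show j.val ≠ 2 by omega,
      show ¬j.val < 3 by omega]
    ring

/-- At a vertex of degree one, `y` equals the share `Z` of its edge, so the edge equation reduces to
`w^k * y_p * y_q = t² * Z²` on a triangle edge and to `w^k * y_c = t² * Z` on a pendant one. These
are the equations of the weighted graph `U_{m,3}` with edge weights `w^(k/2)`, eigenvalue `t` and
entries `√y`. -/
theorem abcSpectralRadius_eq (hk : 3 ≤ k) (hm : 3 ≤ m) (hG : G.IsUniform k)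
    (hκ : G.IsSunCoding m k κ) {t : ℝ} (ht : √2 / 2 < t) (h0 : abcCubic m t = 0) :
    G.abcSpectralRadius k = t ^ ((2 : ℝ) / k) := by
  classical
  have h3 : (3 : ℝ) ≤ m := by exact_mod_cast hm
  have hm1 : (m : ℝ) - 1 ≠ 0 := by linarith
  have hVne : Nonempty V := by
    obtain ⟨⟨v, _⟩⟩ := (Nat.card_ne_zero.1 ((hκ.card_inl 0).symm ▸ one_ne_zero)).1
    exact ⟨v⟩
  rw [abcCubic_eq hm] at h0
  set s : ℝ := √2 / 2 with hs
  have hs0 : 0 < s := by positivity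
  have hs2 : s ^ 2 = 1 / 2 := by
    rw [hs, div_pow, Real.sq_sqrt (by norm_num)]
    norm_num
  have ht0 : 0 < t := hs0.trans ht
  have hts : 0 < t - s := by linarith
  -- The graph eigenvector is `1` at the centre and `b` at the other two triangle vertices, where
  -- the equation is `t * b = s * (b + 1)`.
  set b : ℝ := s / (t - s) with hb
  have hb0 : 0 < b := by positivity
  have hbt : t * b = s * (b + 1) := by
    rw [hb]
    field_simp
    ring
  set p : ℝ := ((m : ℝ) - 2) / (m - 1) with hp
  have hp0 : 0 < p := div_pos (by linarith) (by linarith)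
  set Zc : Fin m → ℝ := fun j =>
    if j.val = 0 then s * b ^ 2 / t else if j.val < 3 then s * b / t else p / t ^ 2 with hZc
  have hZc0 : ∀ j, 0 < Zc j := by
    intro j
    simp only [hZc]
    split_ifs <;> positivity
  set Y : Fin 3 ⊕ Fin m → ℝ := Sum.elim (fun a => if a = 0 then 1 else b ^ 2) Zc with hY
  -- Shares are needed as a function of edges; the default `0` is only taken off the edge set.
  have hZe : ∀ j, Function.extend (edge κ) Zc 0 (edge κ j) = Zc j :=
    fun j => (edge_injective hk hκ).extend_apply _ _ j
  have hr : (t ^ ((2 : ℝ) / k)) ^ k = t ^ 2 := by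
    rw [← Real.rpow_mul_natCast ht0.le, div_mul_cancel₀ _ (by positivity)]
    exact Real.rpow_two t
  refine abcSpectralRadius_eq_of_pos hk hG (Real.rpow_pos_of_pos ht0 _) (fun v => Y (κ v)) ?_
    (Function.extend (edge κ) Zc 0) ?_ ?_ ?_
  · intro v
    rcases κ v with a | j
    · simp only [hY, Sum.elim_inl]
      split_ifs <;> positivity
    · exact hZc0 j
  · intro e he
    rw [hκ.edgeFinset_eq, Finset.mem_image] at he
    obtain ⟨j, _, rfl⟩ := he
    rw [hZe]
    exact hZc0 j
  · intro v
    rw [hκ.sum_edgeFinset_filter hk]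
    simp only [hZe]
    rcases κ v with a | i
    · have hsum : ∑ j, (if SunIncident m (.inl a) j then Zc j else 0) =
          if a = 0 then 2 * (s * b / t) + (m - 3) * (p / t ^ 2)
          else s * b ^ 2 / t + s * b / t := by
        obtain ⟨n, rfl⟩ := Nat.exists_eq_add_of_le' hm
        rw [Fin.sum_univ_succ, Fin.sum_univ_succ, Fin.sum_univ_succ]
        have hlt : ∀ x : ℕ, ¬x + 1 + 1 + 1 < 3 := fun x => by omega
        simp only [SunIncident, Fin.val_succ, Fin.val_zero, hZc, hlt, if_false]
        fin_cases a <;> simp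
        ring
      rw [hsum]
      simp only [hY, Sum.elim_inl]
      split_ifs
      · rw [hb, hp]
        have hq : ((m : ℝ) - 2) * (m - 3) / (m - 1) = (m - 3) * p := by
          rw [hp]
          ring
        rw [hq] at h0
        rw [← hp]
        -- The equation at the centre is the cubic equation, once `2 * s ^ 2 = 1` is used.
        have : 2 * (s * (s / (t - s)) / t) + (m - 3) * (p / t ^ 2) - 1 =
            ((2 * s ^ 2 - 1) * t - ((t ^ 2 - (m - 3) * p) * (t - s) - t)) /
              ((t - s) * t ^ 2) := by
          field_simp
          ring
        rw [h0, hs2] at this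
        norm_num at this
        linarith
      · have : s * b ^ 2 / t + s * b / t = b * (s * (b + 1)) / t := by ring
        rw [this, ← hbt]
        field_simp
    · rw [Finset.sum_eq_single i]
      · exact if_pos rfl
      · intro j _ hj
        exact if_neg fun h : i = j => hj h.symm
      · simp
  · intro e he
    rw [hκ.edgeFinset_eq, Finset.mem_image] at he
    obtain ⟨j, _, rfl⟩ := he
    rw [hZe, hr, hκ.abcWeight_edge_pow hk hm hG, hκ.prod_edge, Fin.prod_univ_three]
    obtain ⟨l, rfl⟩ := Nat.exists_eq_add_of_le' (by omega : 2 ≤ k)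
    simp only [sunIncident_inl_zero, sunIncident_inl_one, sunIncident_inl_two, hY, Sum.elim_inl,
      Sum.elim_inr, if_true, show (1 : Fin 3) ≠ 0 by decide, show (2 : Fin 3) ≠ 0 by decide,
      if_false, Nat.add_sub_cancel, show l + 2 - 1 = l + 1 by omega]
    have hz0 : t ^ 2 * (s * b ^ 2 / t) ^ 2 = 1 / 2 * (b ^ 2 * b ^ 2) := by
      rw [← hs2]
      field_simp
    have hz1 : t ^ 2 * (s * b / t) ^ 2 = 1 / 2 * b ^ 2 := by
      rw [← hs2]
      field_simp
    have hz2 : t ^ 2 * (p / t ^ 2) = p := by field_simp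
    rcases (by omega : j.val = 0 ∨ j.val = 1 ∨ j.val = 2 ∨ 3 ≤ j.val) with h | h | h | h
    · simp only [hZc, h]
      norm_num
      linear_combination -(s * b ^ 2 / t) ^ l * hz0
    · simp only [hZc, h]
      norm_num
      linear_combination -(s * b / t) ^ l * hz1
    · simp only [hZc, h]
      norm_num
      linear_combination -(s * b / t) ^ l * hz1
    · simp only [hZc, show j.val ≠ 0 by omega, show j.val ≠ 1 by omega, show j.val ≠ 2 by omega,
        show ¬j.val < 3 by omega]
      norm_num
      linear_combination -(p / t ^ 2) ^ (l + 1) * hz2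

end IsSunCoding
end Hypergraph

/-! ### Linearity and core vertices of power hypergraphs -/

namespace Hypergraph

/-- Distinct edges have at most one common vertex. -/
def IsLinear {V : Type*} (G : Hypergraph V) : Prop :=
  ∀ e ∈ G.edgeSet, ∀ f ∈ G.edgeSet, ∀ x y, x ∈ e → x ∈ f → y ∈ e → y ∈ f → x ≠ y → e = f

/-- All but at most two vertices of every edge lie in no other edge. -/
def HasCorePairs {V : Type*} (G : Hypergraph V) : Prop :=
  ∀ e ∈ G.edgeSet, ∃ a b, ∀ v ∈ e, v ≠ a → v ≠ b → ∀ f ∈ G.edgeSet, v ∈ f → f = e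

section power

variable {V : Type*} {H : Hypergraph V}

theorem IsUniform.eq_pair (hH : H.IsUniform 2) {e : Set V} (he : e ∈ H.edgeSet) {x y : V}
    (hx : x ∈ e) (hy : y ∈ e) (hxy : x ≠ y) : e = {x, y} := by
  obtain ⟨a, b, _, rfl⟩ := Set.encard_eq_two.1 (hH e he)
  simp only [Set.mem_insert_iff, Set.mem_singleton_iff] at hx hy
  rcases hx with rfl | rfl <;> rcases hy with rfl | rfl
  · exact absurd rfl hxy
  · rfl
  · exact Set.pair_comm _ _
  · exact absurd rfl hxy

/-- The edge of the power that arises from the edge `e`. -/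
abbrev powerEdge (H : Hypergraph V) (r k : ℕ) (e : H.edgeSet) :
    Set (V ⊕ (H.edgeSet × Fin (k - r))) :=
  Sum.inl '' (e : Set V) ∪ Set.range fun s : Fin (k - r) => Sum.inr (e, s)

theorem inl_mem_powerEdge {r k : ℕ} {e : H.edgeSet} {v : V} :
    Sum.inl v ∈ H.powerEdge r k e ↔ v ∈ (e : Set V) := by
  simp [powerEdge]

theorem inr_mem_powerEdge {r k : ℕ} {e f : H.edgeSet} {s : Fin (k - r)} :
    Sum.inr (f, s) ∈ H.powerEdge r k e ↔ f = e := by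
  simp [powerEdge, eq_comm]

theorem powerEdge_injective {r k : ℕ} : Function.Injective (H.powerEdge r k) := by
  intro e f h
  ext v
  rw [← inl_mem_powerEdge (r := r) (k := k), h, inl_mem_powerEdge]

theorem edgeSet_power {r k : ℕ} : (H.power r k).edgeSet = Set.range (H.powerEdge r k) := rfl

theorem vertexSet_power {r k : ℕ} (hH : H.vertexSet = Set.univ) :
    (H.power r k).vertexSet = Set.univ := by
  simp [power, hH]

theorem ncard_edgeSet_power {r k : ℕ} : (H.power r k).edgeSet.ncard = H.edgeSet.ncard := by
  rw [edgeSet_power, ← Set.image_univ, Set.ncard_image_of_injective _ powerEdge_injective,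
    Set.ncard_univ, Nat.card_coe_set_eq]

theorem IsUniform.power {r k : ℕ} (hrk : r ≤ k) (hH : H.IsUniform r) :
    (H.power r k).IsUniform k := by
  rintro _ ⟨e, rfl⟩
  have hinj : Function.Injective fun s : Fin (k - r) => (Sum.inr (e, s) : V ⊕ _) := by
    intro s t h
    simpa using h
  rw [Set.encard_union_eq, Sum.inl_injective.encard_image, hH _ e.2, ← Set.image_univ,
    hinj.encard_image, Set.encard_univ, ENat.card_eq_coe_fintype_card, Fintype.card_fin]
  · exact_mod_cast Nat.add_sub_cancel' hrk
  · rw [Set.disjoint_left]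
    rintro _ ⟨v, _, rfl⟩ ⟨s, hs⟩
    simp at hs

theorem isLinear_power {k : ℕ} (hH : H.IsUniform 2) : (H.power 2 k).IsLinear := by
  rintro _ ⟨e, rfl⟩ _ ⟨f, rfl⟩ x y hxe hxf hye hyf hxy
  suffices e = f by rw [this]
  change x ∈ H.powerEdge 2 k e at hxe
  change x ∈ H.powerEdge 2 k f at hxf
  change y ∈ H.powerEdge 2 k e at hye
  change y ∈ H.powerEdge 2 k f at hyf
  rcases x with x | ⟨g, s⟩
  · rcases y with y | ⟨g, s⟩
    · rw [inl_mem_powerEdge] at hxe hxf hye hyf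
      have hne : x ≠ y := fun h => hxy (h ▸ rfl)
      ext1
      rw [hH.eq_pair e.2 hxe hye hne, hH.eq_pair f.2 hxf hyf hne]
    · rw [inr_mem_powerEdge] at hye hyf
      rw [← hye, hyf]
  · rw [inr_mem_powerEdge] at hxe hxf
    rw [← hxe, hxf]

theorem hasCorePairs_power {k : ℕ} (hH : H.IsUniform 2) : (H.power 2 k).HasCorePairs := by
  rintro _ ⟨e, rfl⟩
  obtain ⟨a, b, _, hab⟩ := Set.encard_eq_two.1 (hH e e.2)
  refine ⟨.inl a, .inl b, fun v hv hva hvb => ?_⟩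
  rintro _ ⟨f, rfl⟩ hvf
  suffices f = e by rw [this]
  change v ∈ H.powerEdge 2 k e at hv
  change v ∈ H.powerEdge 2 k f at hvf
  rcases v with v | ⟨g, s⟩
  · rw [inl_mem_powerEdge, hab] at hv
    rcases hv with rfl | rfl
    · exact absurd rfl hva
    · exact absurd rfl hvb
  · rw [inr_mem_powerEdge] at hv hvf
    rw [← hvf, hv]

end power

section transport

variable {V W : Type*} {G : Hypergraph V} {H : Hypergraph W} (φ : V ≃ W)

theorem IsLinear.of_equiv (hφ : ∀ e, e ∈ G.edgeSet ↔ φ '' e ∈ H.edgeSet) (hH : H.IsLinear) :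
    G.IsLinear := fun e he f hf x y hxe hxf hye hyf hxy =>
  φ.injective.image_injective <| hH _ ((hφ e).1 he) _ ((hφ f).1 hf) (φ x) (φ y)
    ⟨x, hxe, rfl⟩ ⟨x, hxf, rfl⟩ ⟨y, hye, rfl⟩ ⟨y, hyf, rfl⟩ (φ.injective.ne hxy)

theorem HasCorePairs.of_equiv (hφ : ∀ e, e ∈ G.edgeSet ↔ φ '' e ∈ H.edgeSet)
    (hH : H.HasCorePairs) : G.HasCorePairs := by
  intro e he
  obtain ⟨a, b, hab⟩ := hH _ ((hφ e).1 he)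
  refine ⟨φ.symm a, φ.symm b, fun v hv hva hvb f hf hvf => φ.injective.image_injective ?_⟩
  exact hab (φ v) ⟨v, hv, rfl⟩ (fun h => hva (by simp [← h])) (fun h => hvb (by simp [← h]))
    _ ((hφ f).1 hf) ⟨v, hvf, rfl⟩

theorem IsPowerHypergraph.isLinear_and_hasCorePairs {k : ℕ} (hG : G.vertexSet = Set.univ)
    (h : G.IsPowerHypergraph k) : G.IsLinear ∧ G.HasCorePairs := by
  obtain ⟨n, H, hV, hH, hiso⟩ := h
  obtain ⟨φ, hφ⟩ := hiso.exists_equiv hG (vertexSet_power hV)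
  exact ⟨(isLinear_power hH).of_equiv φ hφ, (hasCorePairs_power hH).of_equiv φ hφ⟩

end transport

/-! ### Recognising the power of `U_{m,3}` -/

variable {V : Type*} [Fintype V] {G : Hypergraph V}

theorem IsLinear.eq_of_mem (hG : G.IsLinear) {e f : Finset V} (he : e ∈ G.edgeFinset)
    (hf : f ∈ G.edgeFinset) {x y : V} (hxe : x ∈ e) (hxf : x ∈ f) (hye : y ∈ e) (hyf : y ∈ f)
    (hxy : x ≠ y) : e = f :=
  Finset.coe_injective <|
    hG _ (mem_edgeFinset.1 he) _ (mem_edgeFinset.1 hf) x y hxe hxf hye hyf hxy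

theorem HasCorePairs.exists_pair (hG : G.HasCorePairs) {e : Finset V} (he : e ∈ G.edgeFinset) :
    ∃ a b, ∀ v ∈ e, v ≠ a → v ≠ b → ∀ f ∈ G.edgeFinset, v ∈ f → f = e := by
  obtain ⟨a, b, h⟩ := hG _ (mem_edgeFinset.1 he)
  exact ⟨a, b, fun v hv hva hvb f hf hvf =>
    Finset.coe_injective (h v hv hva hvb _ (mem_edgeFinset.1 hf) hvf)⟩

/-- A finset with `m ≥ 3` elements can be enumerated with three given elements in front. -/
theorem exists_equiv_of_three {α : Type*} {s : Finset α} {m : ℕ} (hm : 3 ≤ m) (hs : s.card = m)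
    {a b c : α} (ha : a ∈ s) (hb : b ∈ s) (hc : c ∈ s) (hab : a ≠ b) (hac : a ≠ c) (hbc : b ≠ c) :
    ∃ ε : Fin m ≃ s, (ε ⟨0, by omega⟩ : α) = a ∧ (ε ⟨1, by omega⟩ : α) = b ∧
      (ε ⟨2, by omega⟩ : α) = c := by
  classical
  obtain ⟨ε, hε⟩ := Finset.exists_equiv_extend_of_card_eq (α := Fin m) (t := s)
    (by rw [hs, Fintype.card_fin])
    (s := {⟨0, by omega⟩, ⟨1, by omega⟩, ⟨2, by omega⟩})
    (f := fun j => if j.val = 0 then a else if j.val = 1 then b else c)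
    (by
      intro e he
      simp only [Finset.mem_image, Finset.mem_insert, Finset.mem_singleton] at he
      obtain ⟨j, rfl | rfl | rfl, rfl⟩ := he <;> simpa)
    (by
      intro i hi j hj hij
      simp only [Finset.coe_insert, Finset.coe_singleton, Set.mem_insert_iff,
        Set.mem_singleton_iff] at hi hj
      rcases hi with rfl | rfl | rfl <;> rcases hj with rfl | rfl | rfl <;>
        simp_all [eq_comm])
  exact ⟨ε, by simpa using hε ⟨0, by omega⟩ (by simp), by simpa using hε ⟨1, by omega⟩ (by simp),
    by simpa using hε ⟨2, by omega⟩ (by simp)⟩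

/-- A linear uniform hypergraph with core pairs, in which all edges but one share a vertex and the
remaining edge meets two of them, is the power of a triangle with pendant edges at a vertex. -/
theorem exists_isSunCoding {m k : ℕ} (hm : 3 ≤ m) (hunif : G.IsUniform k)
    (hcard : G.edgeFinset.card = m) (hcover : ∀ v, ∃ e ∈ G.edgeFinset, v ∈ e)
    (hlin : G.IsLinear) (hcore : G.HasCorePairs) {f e₁ e₂ : Finset V} {c p q : V}
    (hf : f ∈ G.edgeFinset) (he₁ : e₁ ∈ G.edgeFinset) (he₂ : e₂ ∈ G.edgeFinset)
    (hcf : c ∉ f) (hc : ∀ e ∈ G.edgeFinset, e ≠ f → c ∈ e) (hc₁ : c ∈ e₁) (hc₂ : c ∈ e₂)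
    (h12 : e₁ ≠ e₂) (hp₁ : p ∈ e₁) (hpf : p ∈ f) (hq₂ : q ∈ e₂) (hqf : q ∈ f) :
    ∃ κ, G.IsSunCoding m k κ := by
  classical
  have h1f : e₁ ≠ f := fun h => hcf (h ▸ hc₁)
  have h2f : e₂ ≠ f := fun h => hcf (h ▸ hc₂)
  have hcp : c ≠ p := fun h => hcf (h ▸ hpf)
  have hcq : c ≠ q := fun h => hcf (h ▸ hqf)
  have hpq : p ≠ q := fun h => h12 (hlin.eq_of_mem he₁ he₂ hc₁ hc₂ hp₁ (h ▸ hq₂) hcp)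
  have hpmem : ∀ e ∈ G.edgeFinset, p ∈ e ↔ e = f ∨ e = e₁ := by
    intro e he
    constructor
    · intro hp
      by_cases hef : e = f
      · exact .inl hef
      · exact .inr (hlin.eq_of_mem he he₁ (hc e he hef) hc₁ hp hp₁ hcp)
    · rintro (rfl | rfl) <;> assumption
  have hqmem : ∀ e ∈ G.edgeFinset, q ∈ e ↔ e = f ∨ e = e₂ := by
    intro e he
    constructor
    · intro hq
      by_cases hef : e = f
      · exact .inl hef
      · exact .inr (hlin.eq_of_mem he he₂ (hc e he hef) hc₂ hq hq₂ hcq)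
    · rintro (rfl | rfl) <;> assumption
  have hcmem : ∀ e ∈ G.edgeFinset, c ∈ e ↔ e ≠ f :=
    fun e he => ⟨fun h hef => hcf (hef ▸ h), hc e he⟩
  -- Since `p` and `q` lie in further edges, they are the two exceptional vertices of `f`.
  have hf1 : ∀ v ∈ f, v ≠ p → v ≠ q → ∀ e ∈ G.edgeFinset, v ∈ e → e = f := by
    intro v hv hvp hvq
    obtain ⟨a, b, hab⟩ := hcore.exists_pair hf
    have hpab : p = a ∨ p = b := by
      by_contra! h
      exact h1f (hab p hpf h.1 h.2 e₁ he₁ hp₁)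
    have hqab : q = a ∨ q = b := by
      by_contra! h
      exact h2f (hab q hqf h.1 h.2 e₂ he₂ hq₂)
    refine hab v hv ?_ ?_
    · rintro rfl
      rcases hpab with h | rfl
      · exact hvp h.symm
      · rcases hqab with h | h
        · exact hvq h.symm
        · exact hpq h.symm
    · rintro rfl
      rcases hpab with rfl | h
      · rcases hqab with h | h
        · exact hpq h.symm
        · exact hvq h.symm
      · exact hvp h.symm
  -- Two edges other than `f` already share `c`, so by linearity they share nothing else.
  have huniq : ∀ v, v ≠ c → v ≠ p → v ≠ q → ∀ e ∈ G.edgeFinset, ∀ e' ∈ G.edgeFinset,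
      v ∈ e → v ∈ e' → e = e' := by
    intro v hvc hvp hvq e he e' he' hv hv'
    by_cases hef : e = f
    · subst hef
      exact (hf1 v hv hvp hvq e' he' hv').symm
    by_cases hef' : e' = f
    · subst hef'
      exact hf1 v hv' hvp hvq e he hv
    exact hlin.eq_of_mem he he' (hc e he hef) (hc e' he' hef') hv hv' hvc.symm
  obtain ⟨ε, hε0, hε1, hε2⟩ : ∃ ε : Fin m ≃ G.edgeFinset,
      (ε ⟨0, by omega⟩ : Finset V) = f ∧ (ε ⟨1, by omega⟩ : Finset V) = e₁ ∧
        (ε ⟨2, by omega⟩ : Finset V) = e₂ :=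
    exists_equiv_of_three hm hcard hf he₁ he₂ h1f.symm h2f.symm h12
  have hεval : ∀ i j : Fin m, (ε i : Finset V) = ε j ↔ i.val = j.val := by
    intro i j
    rw [Subtype.coe_inj, ε.apply_eq_iff_eq, Fin.ext_iff]
  have hcε : ∀ j, c ∈ (ε j : Finset V) ↔ j.val ≠ 0 := by
    intro j
    rw [hcmem _ (ε j).2, ← hε0, Ne, hεval]
  have hpε : ∀ j, p ∈ (ε j : Finset V) ↔ j.val = 0 ∨ j.val = 1 := by
    intro j
    rw [hpmem _ (ε j).2, ← hε0, ← hε1, hεval, hεval]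
  have hqε : ∀ j, q ∈ (ε j : Finset V) ↔ j.val = 0 ∨ j.val = 2 := by
    intro j
    rw [hqmem _ (ε j).2, ← hε0, ← hε2, hεval, hεval]
  have hidx : ∀ v, ∃ j, v ∈ (ε j : Finset V) := by
    intro v
    obtain ⟨e, he, hv⟩ := hcover v
    exact ⟨ε.symm ⟨e, he⟩, by simpa using hv⟩
  choose idx hidx using hidx
  set κ : V → Fin 3 ⊕ Fin m := fun v =>
    if v = c then .inl 0 else if v = p then .inl 1 else if v = q then .inl 2 else .inr (idx v)
    with hκ
  have hκc : κ c = .inl 0 := by simp [hκ]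
  have hκp : κ p = .inl 1 := by simp [hκ, hcp.symm]
  have hκq : κ q = .inl 2 := by simp [hκ, hcq.symm, hpq.symm]
  have hκo : ∀ v, v ≠ c → v ≠ p → v ≠ q → κ v = .inr (idx v) := by
    intro v h1 h2 h3
    simp [hκ, h1, h2, h3]
  have hinl : ∀ v a, κ v = .inl a → (v = c ∧ a = 0) ∨ (v = p ∧ a = 1) ∨ (v = q ∧ a = 2) := by
    intro v a h
    by_cases h1 : v = c
    · rw [h1, hκc] at h
      exact .inl ⟨h1, (Sum.inl_injective h).symm⟩
    by_cases h2 : v = p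
    · rw [h2, hκp] at h
      exact .inr (.inl ⟨h2, (Sum.inl_injective h).symm⟩)
    by_cases h3 : v = q
    · rw [h3, hκq] at h
      exact .inr (.inr ⟨h3, (Sum.inl_injective h).symm⟩)
    · rw [hκo v h1 h2 h3] at h
      exact absurd h Sum.inr_ne_inl
  have hmem : ∀ v j, v ∈ (ε j : Finset V) ↔ SunIncident m (κ v) j := by
    intro v j
    by_cases h1 : v = c
    · rw [h1, hκc, sunIncident_inl_zero, hcε]
    by_cases h2 : v = p
    · rw [h2, hκp, sunIncident_inl_one, hpε]
    by_cases h3 : v = q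
    · rw [h3, hκq, sunIncident_inl_two, hqε]
    rw [hκo v h1 h2 h3]
    change _ ↔ idx v = j
    constructor
    · intro h
      exact ε.injective (Subtype.ext (huniq v h1 h2 h3 _ (ε _).2 _ (ε j).2 (hidx v) h))
    · rintro rfl
      exact hidx v
  refine ⟨κ, ?_, fun a => ?_, fun j => ?_⟩
  · rw [← image_coe_edgeFinset]
    ext e
    constructor
    · rintro ⟨e, he, rfl⟩
      refine ⟨ε.symm ⟨e, he⟩, ?_⟩
      ext v
      rw [Set.mem_ofPred_eq, ← hmem]
      simp
    · rintro ⟨j, rfl⟩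
      refine ⟨ε j, (ε j).2, ?_⟩
      ext v
      rw [Set.mem_ofPred_eq, ← hmem, Finset.mem_coe]
  · have key : ∀ w : V, κ w = .inl a → (∀ v, κ v = .inl a → v = w) →
        Nat.card {v // κ v = .inl a} = 1 := by
      intro w hw h
      rw [Nat.subtype_card {w}, Finset.card_singleton]
      intro v
      rw [Finset.mem_singleton]
      exact ⟨fun h => h ▸ hw, h v⟩
    fin_cases a
    · exact key c hκc fun v hv => (hinl v _ hv).resolve_right (by simp) |>.1
    · exact key p hκp fun v hv => ((hinl v _ hv).resolve_left (by simp)).resolve_right (by simp) |>.1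
    · exact key q hκq fun v hv => ((hinl v _ hv).resolve_left (by simp)).resolve_left (by simp) |>.1
  -- Each of the edges `0`, `1`, `2` contains exactly two of `c`, `p`, `q`; every other edge
  -- contains only `c`.
  · rw [Nat.subtype_card ((ε j : Finset V) \ {c, p, q}), Finset.card_sdiff,
      hunif.card_eq (ε j).2]
    · rcases (by omega : j.val = 0 ∨ j.val = 1 ∨ j.val = 2 ∨ 3 ≤ j.val) with h | h | h | h
      · rw [Finset.insert_inter_of_notMem (by simp [hcε, h]),
          Finset.inter_eq_left.2 (by simp [Finset.insert_subset_iff, hpε, hqε, h]),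
          Finset.card_pair hpq, if_pos (by omega)]
      · rw [Finset.insert_inter_of_mem (by simp [hcε, h]),
          Finset.insert_inter_of_mem (by simp [hpε, h]),
          Finset.singleton_inter_of_notMem (by simp [hqε, h]), insert_empty_eq,
          Finset.card_pair hcp, if_pos (by omega)]
      · rw [Finset.insert_inter_of_mem (by simp [hcε, h]),
          Finset.insert_inter_of_notMem (by simp [hpε, h]),
          Finset.singleton_inter_of_mem (by simp [hqε, h]),
          Finset.card_pair hcq, if_pos (by omega)]
      · rw [Finset.insert_inter_of_mem (by simp [hcε]; omega),
          Finset.insert_inter_of_notMem (by simp [hpε]; omega),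
          Finset.singleton_inter_of_notMem (by simp [hqε]; omega), insert_empty_eq,
          Finset.card_singleton, if_neg (by omega)]
    · intro v
      rw [Finset.mem_sdiff, hmem]
      constructor
      · rintro ⟨h, hv⟩
        simp only [Finset.mem_insert, Finset.mem_singleton, not_or] at hv
        rw [hκo v hv.1 hv.2.1 hv.2.2] at h ⊢
        exact congrArg _ h
      · intro h
        refine ⟨h ▸ rfl, fun hv => ?_⟩
        simp only [Finset.mem_insert, Finset.mem_singleton] at hv
        rcases hv with hv | hv | hv
        · exact Sum.inl_ne_inr (hκc.symm.trans (hv ▸ h))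
        · exact Sum.inl_ne_inr (hκp.symm.trans (hv ▸ h))
        · exact Sum.inl_ne_inr (hκq.symm.trans (hv ▸ h))

end Hypergraph

/-! ### The graph `U_{m,3}`, and cycles in unicyclic hypergraphs -/

namespace Hypergraph

section unicyclicU

variable {m : ℕ}

theorem mem_edgeSet_unicyclicU_three (hm : 3 ≤ m) {e : Set (Fin m)} :
    e ∈ (unicyclicU m 3).edgeSet ↔ e = {⟨1, by omega⟩, ⟨2, by omega⟩} ∨
      ∃ j : Fin m, j.val ≠ 0 ∧ e = {⟨0, by omega⟩, j} := by
  constructor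
  · rintro ⟨i, j, rfl, h⟩
    rcases h with ⟨h1, h2⟩ | ⟨h1, h2⟩ | ⟨h1, h2⟩
    · rcases (by omega : i.val = 0 ∨ i.val = 1) with h | h
      · have : i = ⟨0, by omega⟩ := Fin.ext h
        exact .inr ⟨j, by omega, by rw [this]⟩
      · left
        rw [show i = ⟨1, by omega⟩ from Fin.ext h,
          show j = ⟨2, by omega⟩ from Fin.ext (by simp only; omega)]
    · exact .inr ⟨j, by omega, by rw [show i = ⟨0, by omega⟩ from Fin.ext h1]⟩
    · exact .inr ⟨j, by omega, by rw [show i = ⟨0, by omega⟩ from Fin.ext h1]⟩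
  · rintro (rfl | ⟨j, hj, rfl⟩)
    · exact ⟨_, _, rfl, .inl ⟨rfl, by simp⟩⟩
    · refine ⟨_, _, rfl, ?_⟩
      simp only [true_and]
      omega

theorem isUniform_unicyclicU_three (hm : 3 ≤ m) : (unicyclicU m 3).IsUniform 2 := by
  intro e he
  rcases (mem_edgeSet_unicyclicU_three hm).1 he with rfl | ⟨j, hj, rfl⟩
  · exact Set.encard_pair (by simp)
  · refine Set.encard_pair ?_
    rintro rfl
    exact hj rfl

theorem ncard_edgeSet_unicyclicU_three (hm : 3 ≤ m) : (unicyclicU m 3).edgeSet.ncard = m := by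
  -- Edges are indexed by vertices: `j ≠ 0` names the edge `{0, j}`, and `0` names the triangle edge
  -- opposite to it.
  set E : Fin m → Set (Fin m) := fun j =>
    if j.val = 0 then {⟨1, by omega⟩, ⟨2, by omega⟩} else {⟨0, by omega⟩, j} with hE
  have hrange : (unicyclicU m 3).edgeSet = Set.range E := by
    ext e
    rw [mem_edgeSet_unicyclicU_three hm]
    constructor
    · rintro (rfl | ⟨j, hj, rfl⟩)
      · exact ⟨⟨0, by omega⟩, by simp [hE]⟩
      · exact ⟨j, by simp [hE, hj]⟩
    · rintro ⟨j, rfl⟩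
      by_cases hj : j.val = 0
      · exact .inl (by simp [hE, hj])
      · exact .inr ⟨j, hj, by simp [hE, hj]⟩
  have h0 : ∀ j : Fin m, (⟨0, by omega⟩ : Fin m) ∈ E j ↔ j.val ≠ 0 := by
    intro j
    by_cases hj : j.val = 0 <;> simp [hE, hj]
  have hinj : Function.Injective E := by
    intro i j h
    have hij := h0 i
    rw [h, h0] at hij
    by_cases hi : i.val = 0
    · exact Fin.ext (by omega)
    · have hj : j.val ≠ 0 := by tauto
      have hmem : i ∈ E i := by simp [hE, hi]
      rw [h] at hmem
      simp only [hE, hj, if_false, Set.mem_insert_iff, Set.mem_singleton_iff] at hmem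
      rcases hmem with rfl | h
      · exact absurd rfl hi
      · exact h
  rw [hrange, ← Set.image_univ, Set.ncard_image_of_injective _ hinj, Set.ncard_univ,
    Nat.card_fin]

/-- The recognition lemma applies to the model itself, with `f` the edge opposite to the centre and
`e₁`, `e₂` the other two triangle edges. -/
theorem exists_isSunCoding_power_unicyclicU {k : ℕ} (hk : 3 ≤ k) (hm : 3 ≤ m) :
    ∃ κ, ((unicyclicU m 3).power 2 k).IsSunCoding m k κ := by
  set U := unicyclicU m 3 with hU
  have hunif := isUniform_unicyclicU_three hm
  let _ : Fintype (Fin m ⊕ (U.edgeSet × Fin (k - 2))) := Fintype.ofFinite _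
  set F : U.edgeSet → Finset (Fin m ⊕ (U.edgeSet × Fin (k - 2))) :=
    fun e => (Set.toFinite (U.powerEdge 2 k e)).toFinset with hF
  have hFmem : ∀ e, F e ∈ (U.power 2 k).edgeFinset := by
    intro e
    rw [mem_edgeFinset, Set.Finite.coe_toFinset]
    exact ⟨e, rfl⟩
  have hall : ∀ e ∈ (U.power 2 k).edgeFinset, ∃ e', e = F e' := by
    intro e he
    obtain ⟨e', he'⟩ := mem_edgeFinset.1 he
    refine ⟨e', Finset.coe_injective ?_⟩
    rw [Set.Finite.coe_toFinset]
    exact he'.symm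
  have hinl : ∀ (e : U.edgeSet) (v : Fin m), Sum.inl v ∈ F e ↔ v ∈ (e : Set (Fin m)) := by
    intro e v
    rw [Set.Finite.mem_toFinset, inl_mem_powerEdge]
  have hinr : ∀ (e : U.edgeSet) s, Sum.inr (e, s) ∈ F e := by
    intro e s
    rw [Set.Finite.mem_toFinset, inr_mem_powerEdge]
  set z : Fin m := ⟨0, by omega⟩ with hz
  set a : Fin m := ⟨1, by omega⟩ with ha
  set b : Fin m := ⟨2, by omega⟩ with hb
  have haz : a ≠ z := by simp [hz, ha]
  have hbz : b ≠ z := by simp [hz, hb]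
  have hab : a ≠ b := by simp [ha, hb]
  let f : U.edgeSet := ⟨{a, b}, (mem_edgeSet_unicyclicU_three hm).2 (.inl rfl)⟩
  have hspoke : ∀ j : Fin m, j ≠ z → ({z, j} : Set (Fin m)) ∈ U.edgeSet := fun j hj =>
    (mem_edgeSet_unicyclicU_three hm).2 (.inr ⟨j, fun h => hj (Fin.ext h), rfl⟩)
  let e₁ : U.edgeSet := ⟨{z, a}, hspoke a haz⟩
  let e₂ : U.edgeSet := ⟨{z, b}, hspoke b hbz⟩
  refine exists_isSunCoding (c := .inl z) (p := .inl a) (q := .inl b) (f := F f) (e₁ := F e₁)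
    (e₂ := F e₂) hm (hunif.power (by omega)) ?_ ?_ (isLinear_power hunif)
    (hasCorePairs_power hunif) (hFmem _) (hFmem _) (hFmem _) ?_ ?_ ?_ ?_ ?_ ?_ ?_ ?_ ?_
  · rw [← ncard_edgeSet, ncard_edgeSet_power, ncard_edgeSet_unicyclicU_three hm]
  · rintro (v | ⟨e, s⟩)
    · by_cases hv : v = z
      · exact ⟨F e₁, hFmem _, by rw [hinl, hv]; exact Set.mem_insert _ _⟩
      · exact ⟨F ⟨_, hspoke v hv⟩, hFmem _, by rw [hinl]; simp⟩
    · exact ⟨F e, hFmem e, hinr e s⟩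
  · rw [hinl]
    rintro (h | h)
    · exact haz h.symm
    · exact hbz h.symm
  · intro e he hef
    obtain ⟨⟨e, he'⟩, rfl⟩ := hall e he
    rw [hinl]
    rcases (mem_edgeSet_unicyclicU_three hm).1 he' with rfl | ⟨j, hj, rfl⟩
    · exact absurd rfl hef
    · exact Set.mem_insert _ _
  · rw [hinl]
    exact Set.mem_insert _ _
  · rw [hinl]
    exact Set.mem_insert _ _
  · intro h
    have : Sum.inl a ∈ F e₂ := by
      rw [← h, hinl]
      exact Set.mem_insert_of_mem _ rfl
    rw [hinl] at this
    rcases this with h | h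
    · exact haz h
    · exact hab h
  all_goals
    rw [hinl]
    simp [e₁, e₂, f]

end unicyclicU

section

variable {V : Type*} {G : Hypergraph V}

/-- A triangle formed by two edges through `u` and an edge `f` is a cycle. -/
theorem mem_cycles_of_triangle {u a b : V} {e f g : Set V} (he : e ∈ G.edgeSet)
    (hf : f ∈ G.edgeSet) (hg : g ∈ G.edgeSet) (hue : u ∈ e) (hug : u ∈ g) (huf : u ∉ f)
    (hae : a ∈ e) (haf : a ∈ f) (hbg : b ∈ g) (hbf : b ∈ f) (hab : a ≠ b) (heg : e ≠ g) :
    (({u, a, b} : Set V), ({e, f, g} : Set (Set V))) ∈ G.cycles := by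
  have hua : u ≠ a := fun h => huf (h ▸ haf)
  have hub : u ≠ b := fun h => huf (h ▸ hbf)
  have hef : e ≠ f := fun h => huf (h ▸ hue)
  have hgf : g ≠ f := fun h => huf (h ▸ hug)
  have hinj : ∀ {α : Type _} {x y z : α}, x ≠ y → x ≠ z → y ≠ z →
      Function.Injective (![x, y, z] : Fin 3 → α) := by
    intro α x y z h1 h2 h3 i j h
    fin_cases i <;> fin_cases j <;> simp_all [eq_comm]
  have hrange : ∀ {α : Type _} (x y z : α), Set.range (![x, y, z] : Fin 3 → α) = {x, y, z} := by
    intro α x y z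
    ext w
    simp only [Matrix.range_cons, Matrix.range_empty, Set.union_empty, Set.mem_union,
      Set.mem_insert_iff, Set.mem_singleton_iff]
  refine ⟨3, by norm_num, (![u, a, b] : Fin 3 → V), (![e, f, g] : Fin 3 → Set V),
    hinj hua hub hab, hinj hef heg hgf.symm, ?_, ?_, ?_⟩
  · have hall : ∀ P : ZMod 3 → Prop, P 0 → P 1 → P 2 → ∀ i, P i := by
      intro P h0 h1 h2 i
      fin_cases i <;> assumption
    exact hall _ ⟨he, hue, hae⟩ ⟨hf, haf, hbf⟩ ⟨hg, hbg, hug⟩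
  -- Modulo `3` any two indices are equal or consecutive, so disjointness is never required.
  · intro i j h1 h2 h3
    exact absurd h3 (by revert i j; decide)
  · exact Prod.ext (hrange u a b).symm (hrange e f g).symm

end

variable {V : Type*} [Fintype V] {G : Hypergraph V}

/-- Disjointness of non-consecutive edges is dropped: linearity and the distinctness of vertices and
edges suffice when the cycle is used. -/
theorem exists_cycle_of_isUnicyclic (hG : G.IsUnicyclic) :
    ∃ l : ℕ, 2 ≤ l ∧ ∃ (v : ZMod l → V) (e : ZMod l → Finset V),
      Function.Injective v ∧ Function.Injective e ∧
      ∀ i, e i ∈ G.edgeFinset ∧ v i ∈ e i ∧ v (i + 1) ∈ e i := by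
  obtain ⟨_, _, ⟨l, hl, v, e, hv, he, h, _⟩, _⟩ := hG
  refine ⟨l, hl, v, fun i => (Set.toFinite (e i)).toFinset, hv, fun i j hij => he ?_, fun i => ?_⟩
  · simpa using hij
  · simpa [mem_edgeFinset] using h i

theorem IsUnicyclic.exists_mem_edgeFinset (hG : G.IsUnicyclic) (hV : G.vertexSet = Set.univ)
    (v : V) : ∃ e ∈ G.edgeFinset, v ∈ e := by
  obtain ⟨l, hl, w, _, hw, _⟩ := exists_cycle_of_isUnicyclic hG
  have : Fact (1 < l) := ⟨hl⟩
  obtain ⟨x, hx⟩ : ∃ x, x ≠ v := by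
    by_cases h : w 0 = v
    · exact ⟨w 1, fun h' => zero_ne_one (hw (h.trans h'.symm))⟩
    · exact ⟨_, h⟩
  rcases (hG.1.2 v (by simp [hV]) x (by simp [hV])).cases_head with h | ⟨y, ⟨e, he, hve, _⟩, _⟩
  · exact absurd h.symm hx
  · exact ⟨(Set.toFinite e).toFinset, by simpa [mem_edgeFinset] using he, by simpa using hve⟩

/-- In a linear unicyclic hypergraph every vertex `c` is missed by some edge `f`; if `c` lies in
all other edges, then `f` meets two of them. -/
theorem IsUnicyclic.exists_notMem (hG : G.IsUnicyclic) (hlin : G.IsLinear) (c : V) :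
    ∃ f ∈ G.edgeFinset, c ∉ f ∧ ((∀ e ∈ G.edgeFinset, e ≠ f → c ∈ e) →
      ∃ e₁ ∈ G.edgeFinset, ∃ e₂ ∈ G.edgeFinset, ∃ p q, c ∈ e₁ ∧ c ∈ e₂ ∧ e₁ ≠ e₂ ∧
        p ∈ e₁ ∧ p ∈ f ∧ q ∈ e₂ ∧ q ∈ f) := by
  obtain ⟨l, hl, v, e, hv, he, h⟩ := exists_cycle_of_isUnicyclic hG
  have : Fact (1 < l) := ⟨hl⟩
  have hpred : ∀ i, v i ∈ e (i - 1) := fun i => by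
    have := (h (i - 1)).2.2
    rwa [sub_add_cancel] at this
  -- If `c` lay in every cycle edge, then each `v i`, being common to the distinct edges `e (i - 1)`
  -- and `e i`, would equal `c`.
  have hex : ∃ i, c ∉ e i := by
    by_contra! hall
    have hvc : ∀ i, v i = c := by
      intro i
      by_contra hne
      have := he (hlin.eq_of_mem (h i).1 (h (i - 1)).1 (h i).2.1 (hpred i) (hall _) (hall _) hne)
      exact one_ne_zero (sub_eq_self.1 this.symm)
    exact zero_ne_one (hv ((hvc 0).trans (hvc 1).symm))
  obtain ⟨i, hi⟩ := hex
  refine ⟨e i, (h i).1, hi, fun hc => ?_⟩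
  have hsucc : e (i + 1) ≠ e i := fun h => one_ne_zero (add_eq_left.1 (he h))
  have hpre : e (i - 1) ≠ e i := fun h => one_ne_zero (sub_eq_self.1 (he h))
  have hvne : v i ≠ v (i + 1) := fun h => one_ne_zero (add_eq_left.1 (hv h).symm)
  -- The two cycle neighbours of `f = e i` serve. If they coincided (as for length `2`), they would
  -- share both `v i` and `v (i + 1)` with `f`, against linearity.
  refine ⟨_, (h (i + 1)).1, _, (h (i - 1)).1, v (i + 1), v i, hc _ (h _).1 hsucc,
    hc _ (h _).1 hpre, fun heq => ?_, (h (i + 1)).2.1, (h i).2.2, hpred i, (h i).2.1⟩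
  exact hpre (hlin.eq_of_mem (h _).1 (h i).1 (hpred i) (h i).2.1 (heq ▸ (h (i + 1)).2.1) (h i).2.2
    hvne)

theorem IsUnicyclic.exists_two_le_degree (hG : G.IsUnicyclic) : ∃ v, 2 ≤ G.degree v := by
  classical
  obtain ⟨l, hl, v, e, hv, he, h⟩ := exists_cycle_of_isUnicyclic hG
  have : Fact (1 < l) := ⟨hl⟩
  refine ⟨v (0 + 1), ?_⟩
  rw [degree_eq_card]
  refine Finset.one_lt_card.2 ⟨e 0, Finset.mem_filter.2 ⟨(h 0).1, (h 0).2.2⟩, e (0 + 1),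
    Finset.mem_filter.2 ⟨(h _).1, (h _).2.1⟩, fun h => zero_ne_one (α := ZMod l) ?_⟩
  simpa using he h

end Hypergraph

/-! ### Degree sums around a vertex and the resulting spectral bound -/

namespace Hypergraph

variable {V : Type*} [Fintype V] {G : Hypergraph V}

/-- Among the edges avoiding `u`, at most one meets two of the edges at `u`, and none meets more,
as there is only one cycle. -/
theorem IsUnicyclic.sum_sum_degree_le [DecidableEq V] {k : ℕ} (hG : G.IsUnicyclic)
    (hunif : G.IsUniform k) (hlin : G.IsLinear) (hcore : G.HasCorePairs) (u : V) :
    ∑ e ∈ G.edgeFinset with u ∈ e, ∑ i ∈ e, G.degree i + 2 * G.degree u ≤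
      G.degree u * (k + G.degree u) + G.edgeFinset.card + 1 := by
  set E := G.edgeFinset with hE
  set Eu := E.filter (u ∈ ·) with hEu
  -- Double counting turns the degree sum into `∑ f, N f`. An edge at `u` contributes at most `k +
  -- d_u - 1`, an edge avoiding `u` at most `1`, with one possible exception contributing `2`.
  set N : Finset V → ℕ := fun f => ∑ e ∈ Eu, (e ∩ f).card with hN
  have hdeg : G.degree u = Eu.card := degree_eq_card G u
  have hswap : ∑ e ∈ Eu, ∑ i ∈ e, G.degree i = ∑ f ∈ E, N f := by
    rw [hN, Finset.sum_comm]
    refine Finset.sum_congr rfl fun e _ => ?_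
    simp only [degree_eq_card, Finset.card_filter, ← Finset.filter_mem_eq_inter]
    exact Finset.sum_comm
  have hinter : ∀ e ∈ E, ∀ f ∈ E, e ≠ f → (e ∩ f).card ≤ 1 := by
    intro e he f hf hef
    refine Finset.card_le_one.2 fun x hx y hy => ?_
    rw [Finset.mem_inter] at hx hy
    by_contra hxy
    exact hef (hlin.eq_of_mem he hf hx.1 hx.2 hy.1 hy.2 hxy)
  have hin : ∀ f ∈ Eu, N f + 1 ≤ k + Eu.card := by
    intro f hf
    have hfE := (Finset.mem_filter.1 hf).1
    have h1 : ∑ e ∈ Eu.erase f, (e ∩ f).card ≤ (Eu.erase f).card := by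
      rw [Finset.card_eq_sum_ones (Eu.erase f)]
      refine Finset.sum_le_sum fun e he => ?_
      rw [Finset.mem_erase] at he
      exact hinter e (Finset.mem_filter.1 he.2).1 f hfE he.1
    have h2 : N f = (f ∩ f).card + ∑ e ∈ Eu.erase f, (e ∩ f).card :=
      (Finset.add_sum_erase Eu (fun e => (e ∩ f).card) hf).symm
    rw [Finset.inter_self, hunif.card_eq hfE] at h2
    have h3 := Finset.card_erase_add_one hf
    omega
  -- For `u ∉ f`, linearity puts each vertex of `f` in at most one edge at `u`, so `N f` is at most
  -- the number of vertices of `f` reached from `u`; these are not core vertices of `f`.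
  set T : Finset V → Finset V := fun f => f.filter fun i => ∃ e ∈ Eu, i ∈ e with hT
  have hNT : ∀ f ∈ E, u ∉ f → N f ≤ (T f).card := by
    intro f _ huf
    have : N f = ∑ i ∈ f, (Eu.filter (i ∈ ·)).card := by
      have hcomm : N f = ∑ e ∈ Eu, (f ∩ e).card :=
        Finset.sum_congr rfl fun e _ => by rw [Finset.inter_comm]
      simp only [hcomm, Finset.card_filter, ← Finset.filter_mem_eq_inter]
      exact Finset.sum_comm
    rw [this, hT, Finset.card_filter]
    refine Finset.sum_le_sum fun i hi => ?_
    split_ifs with h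
    · refine Finset.card_le_one.2 fun e he e' he' => ?_
      simp only [hEu, Finset.mem_filter] at he he'
      exact hlin.eq_of_mem he.1.1 he'.1.1 he.1.2 he'.1.2 he.2 he'.2 fun hui => huf (hui ▸ hi)
    · rw [Nat.le_zero, Finset.card_eq_zero, Finset.filter_eq_empty_iff]
      exact fun e he hie => h ⟨e, he, hie⟩
  have hT2 : ∀ f ∈ E, u ∉ f → (T f).card ≤ 2 := by
    intro f hf huf
    obtain ⟨a, b, hab⟩ := hcore.exists_pair hf
    refine (Finset.card_le_card (t := {a, b}) fun i hi => ?_).trans Finset.card_le_two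
    obtain ⟨hif, e, he, hie⟩ := Finset.mem_filter.1 hi
    rw [Finset.mem_insert, Finset.mem_singleton]
    by_contra! h
    rw [hEu, Finset.mem_filter] at he
    exact huf (hab i hif h.1 h.2 e he.1 hie ▸ he.2)
  have htri : ∀ f ∈ E, u ∉ f → 2 ≤ N f → ∃ e g : Finset V, u ∈ e ∧ u ∈ g ∧ ∃ c : Set V,
      (c, ({(e : Set V), (f : Set V), (g : Set V)} : Set (Set V))) ∈ G.cycles := by
    intro f hf huf h2
    obtain ⟨a, ha, b, hb, hab⟩ := Finset.one_lt_card.1 (h2.trans (hNT f hf huf))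
    obtain ⟨haf, e, he, hae⟩ := Finset.mem_filter.1 ha
    obtain ⟨hbf, g, hg, hbg⟩ := Finset.mem_filter.1 hb
    rw [hEu, Finset.mem_filter] at he hg
    refine ⟨e, g, he.2, hg.2, _, mem_cycles_of_triangle (mem_edgeFinset.1 he.1)
      (mem_edgeFinset.1 hf) (mem_edgeFinset.1 hg.1) he.2 hg.2 huf hae haf hbg hbf hab
      fun heg => huf ?_⟩
    have heg' := Finset.coe_injective heg
    exact hlin.eq_of_mem he.1 hf hae haf (heg' ▸ hbg) hbf hab ▸ he.2
  set E' := E.filter (u ∉ ·) with hE'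
  -- The triangles arising from `f` and `f'` are the same cycle, and each contains just one edge
  -- avoiding `u`.
  have hone : (E'.filter fun f => 2 ≤ N f).card ≤ 1 := by
    refine Finset.card_le_one.2 fun f hf f' hf' => ?_
    simp only [hE', Finset.mem_filter] at hf hf'
    obtain ⟨e, g, hue, hug, c, hc⟩ := htri f hf.1.1 hf.1.2 hf.2
    obtain ⟨e', g', hue', hug', c', hc'⟩ := htri f' hf'.1.1 hf'.1.2 hf'.2
    have heq := (Prod.ext_iff.1 (hG.2.unique hc hc')).2
    dsimp only at heq
    have hmem : (f : Set V) ∈ ({(e' : Set V), (f' : Set V), (g' : Set V)} : Set (Set V)) := by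
      rw [← heq]
      simp
    rcases hmem with h | h | h
    · exact absurd (Finset.coe_injective h ▸ hue') hf.1.2
    · exact Finset.coe_injective h
    · exact absurd (Finset.coe_injective h ▸ hug') hf.1.2
  have hout : ∑ f ∈ E', N f ≤ E'.card + 1 := by
    calc ∑ f ∈ E', N f ≤ ∑ f ∈ E', (1 + if 2 ≤ N f then 1 else 0) := by
          refine Finset.sum_le_sum fun f hf => ?_
          rw [hE', Finset.mem_filter] at hf
          have := (hNT f hf.1 hf.2).trans (hT2 f hf.1 hf.2)
          split_ifs <;> omega
      _ = E'.card + (E'.filter fun f => 2 ≤ N f).card := by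
          rw [Finset.sum_add_distrib, ← Finset.card_eq_sum_ones, ← Finset.card_filter]
      _ ≤ _ := by omega
  have hins : ∑ f ∈ Eu, N f + Eu.card ≤ Eu.card * (k + Eu.card) := by
    calc ∑ f ∈ Eu, N f + Eu.card = ∑ f ∈ Eu, (N f + 1) := by
          rw [Finset.sum_add_distrib, Finset.card_eq_sum_ones]
      _ ≤ ∑ f ∈ Eu, (k + Eu.card) := Finset.sum_le_sum hin
      _ = _ := by rw [Finset.sum_const, smul_eq_mul]
  have hsplit : ∑ f ∈ Eu, N f + ∑ f ∈ E', N f = ∑ f ∈ E, N f :=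
    Finset.sum_filter_add_sum_filter_not E (u ∈ ·) N
  have hcards : Eu.card + E'.card = E.card :=
    Finset.card_filter_add_card_filter_not (s := E) (u ∈ ·)
  rw [hswap, hdeg]
  omega

theorem IsUnicyclic.sum_sum_degree_sub_one_le [DecidableEq V] {k : ℕ} (hG : G.IsUnicyclic)
    (hunif : G.IsUniform k) (hlin : G.IsLinear) (hcore : G.HasCorePairs) (u : V) :
    ∑ e ∈ G.edgeFinset with u ∈ e, ∑ i ∈ e, ((G.degree i : ℝ) - 1) ≤
      (G.degree u : ℝ) ^ 2 - 2 * G.degree u + G.edgeFinset.card + 1 := by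
  have h : ((∑ e ∈ G.edgeFinset with u ∈ e, ∑ i ∈ e, G.degree i + 2 * G.degree u : ℕ) : ℝ) ≤
      ((G.degree u * (k + G.degree u) + G.edgeFinset.card + 1 : ℕ) : ℝ) :=
    Nat.cast_le.2 (hG.sum_sum_degree_le hunif hlin hcore u)
  push_cast at h
  have hS : ∑ e ∈ G.edgeFinset with u ∈ e, ∑ i ∈ e, ((G.degree i : ℝ) - 1) =
      ∑ e ∈ G.edgeFinset with u ∈ e, ∑ i ∈ e, (G.degree i : ℝ) - G.degree u * k := by
    rw [degree_eq_card G u, ← nsmul_eq_mul, ← Finset.sum_const, ← Finset.sum_sub_distrib]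
    refine Finset.sum_congr rfl fun e he => ?_
    rw [sum_degree_sub hunif (Finset.mem_filter.1 he).1]
  rw [hS]
  linarith [show (G.degree u : ℝ) * (k + G.degree u) = G.degree u * k + (G.degree u : ℝ) ^ 2 by
    ring]

theorem HasCorePairs.card_filter_degree_le_two (hcore : G.HasCorePairs)
    {e : Finset V} (he : e ∈ G.edgeFinset) : (e.filter fun i => 2 ≤ G.degree i).card ≤ 2 := by
  classical
  obtain ⟨a, b, hab⟩ := hcore.exists_pair he
  refine (Finset.card_le_card (t := {a, b}) fun i hi => ?_).trans Finset.card_le_two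
  rw [Finset.mem_filter, degree_eq_card] at hi
  obtain ⟨f, hf, g, hg, hfg⟩ := Finset.one_lt_card.1 hi.2
  rw [Finset.mem_filter] at hf hg
  rw [Finset.mem_insert, Finset.mem_singleton]
  by_contra! h
  exact hfg ((hab i hi.1 h.1 h.2 f hf.1 hf.2).trans (hab i hi.1 h.1 h.2 g hg.1 hg.2).symm)

theorem sum_degree_sub_one_eq_sum_filter {e : Finset V} (he : e ∈ G.edgeFinset) :
    ∑ i ∈ e, ((G.degree i : ℝ) - 1) = ∑ i ∈ e with 2 ≤ G.degree i, ((G.degree i : ℝ) - 1) := by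
  rw [Finset.sum_filter]
  refine Finset.sum_congr rfl fun i hi => ?_
  split_ifs with h
  · rfl
  · have : G.degree i = 1 := by
      have := one_le_degree he hi
      omega
    rw [this, Nat.cast_one, sub_self]

theorem prod_degree_eq_prod_filter {e : Finset V} (he : e ∈ G.edgeFinset) :
    ∏ i ∈ e, (G.degree i : ℝ) = ∏ i ∈ e with 2 ≤ G.degree i, (G.degree i : ℝ) := by
  rw [Finset.prod_filter]
  refine Finset.prod_congr rfl fun i hi => ?_
  split_ifs with h
  · rfl
  · have : G.degree i = 1 := by
      have := one_le_degree he hi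
      omega
    rw [this, Nat.cast_one]

/-- The bound `ρ^k ≤ max_u (1/d_u) ∑_{e ∋ u} ∑_{i ∈ e} (d_i - 1)`. -/
theorem abcSpectralRadius_le_of_sum_le [DecidableEq V] [Nonempty V] {k : ℕ} (hk : 3 ≤ k)
    (hunif : G.IsUniform k) (hcore : G.HasCorePairs) {M : ℝ} (hM : 0 < M)
    (hdeg : ∀ u, (G.degree u : ℝ) - 1 ≤ M)
    (hsum : ∀ u, 2 ≤ G.degree u → ∑ e ∈ G.edgeFinset with u ∈ e, ∑ i ∈ e, ((G.degree i : ℝ) - 1) ≤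
      G.degree u * M) :
    G.abcSpectralRadius k ≤ M ^ ((1 : ℝ) / k) := by
  set S : Finset V → ℝ := fun e => ∑ i ∈ e, ((G.degree i : ℝ) - 1) with hS
  have hMsq : √M ^ 2 = M := Real.sq_sqrt hM.le
  have hMpos : 0 < √M := Real.sqrt_pos.2 hM
  have hr : (M ^ ((1 : ℝ) / k)) ^ k = M := by
    rw [one_div]
    exact Real.rpow_inv_natCast_pow hM.le (by omega)
  -- The vertex sums are at most `1` by Cauchy–Schwarz. On an edge with two vertices of degree at
  -- least `2` the labels multiply to exactly `S e / (M * d_a * d_b)`; on an edge with one such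
  -- vertex, `d_a - 1 ≤ M` is needed.
  refine abcSpectralRadius_le_of_labelling hk hunif (Real.rpow_nonneg hM.le _)
    (fun i e => if 2 ≤ G.degree i then √(S e) / (G.degree i * √M) else 1) ?_ ?_ ?_
  · intro i e _
    split_ifs <;> positivity
  · intro u
    by_cases hu : 2 ≤ G.degree u
    · simp only [hu, if_true]
      have hu0 : (0 : ℝ) < G.degree u := by
        have : 0 < G.degree u := by omega
        exact_mod_cast this
      rw [← Finset.sum_div, div_le_one (by positivity)]
      refine le_of_sq_le_sq ?_ (by positivity)
      calc (∑ e ∈ G.edgeFinset with u ∈ e, √(S e)) ^ 2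
          ≤ (G.edgeFinset.filter (u ∈ ·)).card * ∑ e ∈ G.edgeFinset with u ∈ e, √(S e) ^ 2 :=
            sq_sum_le_card_mul_sum_sq
        _ = G.degree u * ∑ e ∈ G.edgeFinset with u ∈ e, S e := by
            rw [← degree_eq_card]
            congr 1
            refine Finset.sum_congr rfl fun e he => Real.sq_sqrt ?_
            exact sum_degree_sub_one_nonneg (Finset.mem_filter.1 he).1
        _ ≤ G.degree u * (G.degree u * M) := mul_le_mul_of_nonneg_left (hsum u hu) hu0.le
        _ = (G.degree u * √M) ^ 2 := by rw [mul_pow, hMsq]; ring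
    · simp only [hu, if_false, Finset.sum_const, nsmul_eq_mul, mul_one, ← degree_eq_card]
      exact_mod_cast (by omega : G.degree u ≤ 1)
  · intro e he
    have hS0 : 0 ≤ S e := sum_degree_sub_one_nonneg he
    have hsq : √(S e) ^ 2 = S e := Real.sq_sqrt hS0
    have hcard := hcore.card_filter_degree_le_two he
    rw [hr, abcWeight_pow (by omega) hunif he, ← Finset.prod_filter,
      prod_degree_eq_prod_filter he]
    change S e / _ ≤ _
    have hSe : S e = _ := sum_degree_sub_one_eq_sum_filter he
    have hpos : ∀ i ∈ e.filter (fun i => 2 ≤ G.degree i), (0 : ℝ) < G.degree i := by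
      intro i hi
      have := (Finset.mem_filter.1 hi).2
      exact_mod_cast (by omega : 0 < G.degree i)
    set D := e.filter fun i => 2 ≤ G.degree i with hD
    rcases (by omega : D.card = 0 ∨ D.card = 1 ∨ D.card = 2) with h | h | h
    · rw [Finset.card_eq_zero] at h
      rw [h, Finset.sum_empty] at hSe
      rw [h, hSe]
      simpa using hM.le
    · obtain ⟨a, ha⟩ := Finset.card_eq_one.1 h
      rw [ha] at hpos hSe ⊢
      rw [Finset.sum_singleton] at hSe
      have ha0 := hpos a (Finset.mem_singleton_self a)
      rw [Finset.prod_singleton, Finset.prod_singleton]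
      have hle : √(S e) ≤ √M := Real.sqrt_le_sqrt (hSe ▸ hdeg a)
      have : M * (√(S e) / (G.degree a * √M)) = √M * √(S e) / G.degree a := by
        nth_rewrite 1 [← hMsq]
        field_simp
      rw [this]
      refine div_le_div_of_nonneg_right ?_ ha0.le
      nlinarith [Real.sqrt_nonneg (S e)]
    · obtain ⟨a, b, hab, ha⟩ := Finset.card_eq_two.1 h
      rw [ha] at hpos ⊢
      have ha0 := hpos a (by simp)
      have hb0 := hpos b (by simp)
      rw [Finset.prod_pair hab, Finset.prod_pair hab]
      refine le_of_eq ?_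
      have : M * (√(S e) / (G.degree a * √M) * (√(S e) / (G.degree b * √M))) =
          (√(S e) ^ 2) * (M / √M ^ 2) / (G.degree a * G.degree b) := by
        field_simp
      rw [this, hsq, hMsq, div_self hM.ne', mul_one]

end Hypergraph

/-! ### Comparison with the extremal hypergraph -/

namespace Hypergraph

variable {V : Type*} [Fintype V] {G : Hypergraph V} {m k : ℕ}

/-- A linear unicyclic hypergraph with core pairs and a vertex in all edges but at most one is the
power of a triangle with pendant edges at a vertex. -/
theorem IsUnicyclic.exists_isSunCoding (hm : 3 ≤ m) (hG : G.IsUnicyclic)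
    (hV : G.vertexSet = Set.univ) (hunif : G.IsUniform k) (hlin : G.IsLinear)
    (hcore : G.HasCorePairs) (hcard : G.edgeFinset.card = m) {c : V} (hc : m - 1 ≤ G.degree c) :
    ∃ κ, G.IsSunCoding m k κ := by
  classical
  obtain ⟨f, hf, hcf, h⟩ := hG.exists_notMem hlin c
  have hall : ∀ e ∈ G.edgeFinset, e ≠ f → c ∈ e := by
    intro e he hef
    have hsub : G.edgeFinset.filter (c ∈ ·) ⊆ G.edgeFinset.erase f := by
      intro g hg
      rw [Finset.mem_filter] at hg
      exact Finset.mem_erase.2 ⟨fun h => hcf (h ▸ hg.2), hg.1⟩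
    have heq := Finset.eq_of_subset_of_card_le hsub (by
      rw [Finset.card_erase_of_mem hf, hcard, ← degree_eq_card]
      exact hc)
    have hmem := Finset.mem_erase.2 ⟨hef, he⟩
    rw [← heq] at hmem
    exact (Finset.mem_filter.1 hmem).2
  obtain ⟨e₁, he₁, e₂, he₂, p, q, hc₁, hc₂, h12, hp₁, hpf, hq₂, hqf⟩ := h hall
  exact Hypergraph.exists_isSunCoding hm hunif hcard (hG.exists_mem_edgeFinset hV) hlin hcore hf
    he₁ he₂ hcf hall hc₁ hc₂ h12 hp₁ hpf hq₂ hqf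

/-- If every vertex misses at least two edges, the spectral radius is smaller than the value
attained by the power of a triangle with pendant edges at a vertex. -/
theorem IsUnicyclic.abcSpectralRadius_lt (hk : 3 ≤ k) (hm : 3 ≤ m) (hG : G.IsUnicyclic)
    (hunif : G.IsUniform k) (hlin : G.IsLinear) (hcore : G.HasCorePairs)
    (hcard : G.edgeFinset.card = m) (hdeg : ∀ v, G.degree v + 2 ≤ m) {a : ℝ}
    (ha : ∀ s, abcCubic m s < 0 → s < a) :
    G.abcSpectralRadius k < a ^ ((2 : ℝ) / k) := by
  classical
  have : Nonempty V := ⟨hG.1.1.some⟩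
  suffices h : ∃ M : ℝ, 0 < M ∧ abcCubic m √M < 0 ∧ (∀ u, (G.degree u : ℝ) - 1 ≤ M) ∧
      ∀ u, 2 ≤ G.degree u → ∑ e ∈ G.edgeFinset with u ∈ e, ∑ i ∈ e, ((G.degree i : ℝ) - 1) ≤
        G.degree u * M by
    obtain ⟨M, hM, hcub, h1, h2⟩ := h
    refine (abcSpectralRadius_le_of_sum_le hk hunif hcore hM h1 h2).trans_lt ?_
    have hlt := ha _ hcub
    have h0 : 0 < √M := Real.sqrt_pos.2 hM
    have hM2 : M ^ ((1 : ℝ) / k) = √M ^ ((2 : ℝ) / k) := by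
      rw [Real.sqrt_eq_rpow, ← Real.rpow_mul hM.le]
      congr 1
      ring
    rw [hM2]
    exact Real.rpow_lt_rpow h0.le hlt (by positivity)
  obtain ⟨w, hw⟩ := hG.exists_two_le_degree
  have hm4 : 4 ≤ m := by
    have := hdeg w
    omega
  rcases hm4.eq_or_lt with rfl | hm5
  -- Degrees are at most `2`, so every `S e` is at most `2`. This is sharper than the general degree
  -- sum, which would give `5/2`.
  · refine ⟨2, by norm_num, abcCubic_four_sqrt_two_neg, fun u => ?_, fun u _ => ?_⟩
    · have : (G.degree u : ℝ) ≤ 2 := by exact_mod_cast (by have := hdeg u; omega : G.degree u ≤ 2)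
      linarith
    · rw [degree_eq_card G u, ← nsmul_eq_mul]
      refine Finset.sum_le_card_nsmul _ _ _ fun e he => ?_
      have he := (Finset.mem_filter.1 he).1
      rw [sum_degree_sub_one_eq_sum_filter he]
      calc ∑ i ∈ e with 2 ≤ G.degree i, ((G.degree i : ℝ) - 1)
          ≤ (e.filter fun i => 2 ≤ G.degree i).card • (1 : ℝ) := by
            refine Finset.sum_le_card_nsmul _ _ _ fun i _ => ?_
            have : (G.degree i : ℝ) ≤ 2 := by
              exact_mod_cast (by have := hdeg i; omega : G.degree i ≤ 2)
            linarith
        _ ≤ 2 := by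
            rw [nsmul_eq_mul, mul_one]
            exact_mod_cast hcore.card_filter_degree_le_two he
  · have h5 : (5 : ℝ) ≤ m := by exact_mod_cast hm5
    have hdegR : ∀ u, (G.degree u : ℝ) + 2 ≤ m := fun u => by exact_mod_cast hdeg u
    have hfrac : 0 < 3 / ((m : ℝ) - 2) := div_pos (by norm_num) (by linarith)
    -- The value of `(d² - 2d + m + 1) / d` at `d = m - 2`. By convexity its maximum over `2 ≤ d ≤ m
    -- - 2` is at an end, and `m ≥ 5` makes it this one.
    refine ⟨(m : ℝ) - 3 + 3 / (m - 2), by linarith, abcCubic_sqrt_neg hm5, fun u => ?_,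
      fun u hu => ?_⟩
    · linarith [hdegR u]
    · refine (hG.sum_sum_degree_sub_one_le hunif hlin hcore u).trans ?_
      rw [hcard]
      have h2 : (2 : ℝ) ≤ G.degree u := by exact_mod_cast hu
      have hd := hdegR u
      set d := (G.degree u : ℝ)
      have hkey : d * ((m : ℝ) - 3 + 3 / (m - 2)) - (d ^ 2 - 2 * d + m + 1) =
          (d - 2) * (m - 2 - d) + (m - 5) * (m - 2 - d) / (m - 2) := by
        have : (m : ℝ) - 2 ≠ 0 := by linarith
        field_simp
        ring
      have h3 : 0 ≤ (d - 2) * (m - 2 - d) := mul_nonneg (by linarith) (by linarith)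
      have h4 : 0 ≤ ((m : ℝ) - 5) * (m - 2 - d) / (m - 2) :=
        div_nonneg (mul_nonneg (by linarith) (by linarith)) (by linarith)
      linarith

end Hypergraph

theorem mainTheorem11 {V : Type*} [Fintype V] (k m : ℕ) (hk : 3 ≤ k) (hm : 3 ≤ m)
    (G : Hypergraph V) (hV : G.vertexSet = Set.univ) (hunif : G.IsUniform k)
    (hpow : G.IsPowerHypergraph k) (huni : G.IsUnicyclic) (hsize : G.edgeSet.ncard = m) :
    IsGreatest (G.abcTensor k).eigenvalueModuli (G.abcSpectralRadius k) ∧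
    ∃ a : ℝ, IsGreatest {t : ℝ | abcCubic m t = 0} a ∧
      G.abcSpectralRadius k ≤ a ^ ((2 : ℝ) / k) ∧
      (G.abcSpectralRadius k = a ^ ((2 : ℝ) / k) ↔
        G.IsIsomorphic ((Hypergraph.unicyclicU m 3).power 2 k)) := by
  have hne : Nonempty V := ⟨huni.1.1.some⟩
  refine ⟨Hypergraph.isGreatest_abcSpectralRadius hk hunif, ?_⟩
  obtain ⟨a, ha, hneg⟩ := exists_isGreatest_abcCubic hm
  have hsun : ∀ κ, G.IsSunCoding m k κ → G.abcSpectralRadius k = a ^ ((2 : ℝ) / k) :=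
    fun κ hκ => hκ.abcSpectralRadius_eq hk hm hunif
      (hneg _ (abcCubic_sqrt_two_div_two_neg hm)) ha.1
  obtain ⟨hlin, hcore⟩ := hpow.isLinear_and_hasCorePairs hV
  have hcard : G.edgeFinset.card = m := by rw [← Hypergraph.ncard_edgeSet, hsize]
  have hVU : ((Hypergraph.unicyclicU m 3).power 2 k).vertexSet = Set.univ :=
    Hypergraph.vertexSet_power rfl
  obtain ⟨μ, hμ⟩ := Hypergraph.exists_isSunCoding_power_unicyclicU hk hm
  refine ⟨a, ha, ?_⟩
  -- In the first case both sides of the equivalence hold; in the second the inequality is strict,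
  -- and an isomorphism would force equality.
  by_cases hdeg : ∃ c, m - 1 ≤ G.degree c
  · obtain ⟨c, hc⟩ := hdeg
    obtain ⟨κ, hκ⟩ := huni.exists_isSunCoding hm hV hunif hlin hcore hcard hc
    exact ⟨(hsun κ hκ).le, fun _ => hκ.isIsomorphic hV hVU hμ, fun _ => hsun κ hκ⟩
  · push Not at hdeg
    have hlt := huni.abcSpectralRadius_lt hk hm hunif hlin hcore hcard
      (fun v => by have := hdeg v; omega) hneg
    refine ⟨hlt.le, fun h => absurd h hlt.ne, fun h => ?_⟩
    obtain ⟨κ, hκ⟩ := Hypergraph.IsSunCoding.of_isIsomorphic hV hVU h hμ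
    exact hsun κ hκ
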